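/- Let $F$ be a field, $F_s$ a separable closure of $F$, $\Gamma=\mathrm{Gal}(F_s/F)$, and let $A$ be a central simple $F$-algebra of degree $2n$ ($n\ge 1$) with a quadratic pair $(\sigma,f)$: $\sigma$ is an $F$-linear involution of $A$ with $\dim_F \mathrm{Sym}(A,\sigma)=n(2n+1)$ and $\mathrm{Trd}_A(\mathrm{Skew}(A,\sigma))=0$, and $f\colon \mathrm{Sym}(A,\sigma)\to F$ is a linear map with $f(x+\sigma(x))=\mathrm{Trd}_A(x)$ for all $x\in A$. Let $(\sigma_s,f_s)$ be its extension to $A_s=A\otimes_F F_s$. Points of the Severi--Brauer variety $\mathrm{SB}(A)$ are the $2n$-dimensional right ideals of $A_s$ (with the natural $\Gamma$-action), its linear subvarieties are the right ideals of $A_s$, and the quadric $Q(\sigma,f)\subset \mathrm{SB}(A)$ consists of the points $I$ with $\sigma_s(I)I=0$ and $f_s(I\cap\mathrm{Sym}(\sigma_s))=0$. Let $Y$ be a $\Gamma$-set (discrete, with continuous action) of $2n$ elements, $\varphi$ an involution of $Y$ (a $\Gamma$-equivariant map of order $2$ without fixed points), and let $\varepsilon\colon (Y,\varphi)\hookrightarrow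 Q(\sigma,f)$ be an embedding of quadrics, i.e. an injective $\Gamma$-equivariant map $\varepsilon\colon Y\to \mathrm{SB}(A)$ with $\sum_{y\in Y}\varepsilon(y)=A_s$ such that, for every subset $S\subset Y$ containing no pair $\{y,\varphi(y)\}$, the linear subvariety $\sum_{y\in S}\varepsilon(y)$ lies in $Q(\sigma,f)$. Let $$L_s=\{x\in A_s\mid x\,\varepsilon(y)\subset\varepsilon(y)\text{ for all }y\in Y\},\qquad L=L_s^\Gamma\subset A_s^\Gamma=A .$$ Then: (i) $L$ is an étale $F$-algebra of dimension $2n$. (ii) There is a unique bijection $\theta\colon Y\to X(L)=\mathrm{Hom}_{F\text{-alg}}(L,F_s)$ such that $\varepsilon(y)=\{x\in A_s\mid \theta(y)(\ell)\,x=\ell x\text{ for all }\ell\in L\}$ for all $y\in Y$, and $\theta$ is $\Gamma$-equivariant. (iii) There is a unique $F$-algebra endomorphism $\sigma_L$ of $L$ with $\theta(y)\circ\sigma_L=\theta(\varphi(y))$ for all $y\in Y$; it is an involution of the étale algebra $L$ (it satisfies $\sigma_L^2=\mathrm{id}$, and $\xi\mapsto\xi\circ\sigma_L$ has no fixed point on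 $X(L)$). (iv) The inclusion $L\hookrightarrow A$ is an embedding of algebras with involution $(L,\sigma_L)\hookrightarrow(A,\sigma,f)$: one has $\sigma(\ell)=\sigma_L(\ell)$ for all $\ell\in L$, and $f(x)=\mathrm{Trd}_A(\ell x)$ for all $x\in\mathrm{Sym}(A,\sigma)$ and all $\ell\in L$ with $\ell+\sigma_L(\ell)=1$. -/

import Mathlib

open scoped TensorProduct

noncomputable section

namespace QuadricEmbedding

section CentralSimple

variable (F Fs : Type*) [Field F] [Field Fs] [Algebra F Fs]
variable (A : Type*) [Ring A] [Algebra F A]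

/-- `A` is a central simple `F`-algebra of degree `d ≥ 1`: after extension of scalars to the
separable closure `Fs` it becomes the endomorphism algebra of a `d`-dimensional space. -/
def IsCentralSimpleOfDegree (d : ℕ) : Prop :=
  0 < d ∧ Nonempty ((Fs ⊗[F] A) ≃ₐ[Fs] Matrix (Fin d) (Fin d) Fs)

variable {F Fs}

/-- The action `γ ⊗ id` of an element `γ` of the Galois group on `A_s = Fs ⊗ A`. -/
def galoisMap (γ : Gal(Fs/F)) : (Fs ⊗[F] A) →ₐ[F] (Fs ⊗[F] A) :=
  Algebra.TensorProduct.map (γ : Fs →ₐ[F] Fs) (AlgHom.id F A)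

variable {A}

@[simp]
theorem galoisMap_tmul (γ : Gal(Fs/F)) (c : Fs) (a : A) :
    galoisMap A γ (c ⊗ₜ[F] a) = γ c ⊗ₜ[F] a := by
  simp [galoisMap]

theorem galoisMap_smul (γ : Gal(Fs/F)) (c : Fs) (x : Fs ⊗[F] A) :
    galoisMap A γ (c • x) = γ c • galoisMap A γ x := by
  rw [Algebra.smul_def, map_mul, Algebra.smul_def]
  simp [Algebra.TensorProduct.algebraMap_apply]

theorem galoisMap_inv_cancel (γ : Gal(Fs/F)) (x : Fs ⊗[F] A) :
    galoisMap A γ (galoisMap A γ⁻¹ x) = x := by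
  induction x with
  | zero => simp
  | tmul c a => simp
  | add x y hx hy => simp [hx, hy]

theorem galoisMap_inv_cancel' (γ : Gal(Fs/F)) (x : Fs ⊗[F] A) :
    galoisMap A γ⁻¹ (galoisMap A γ x) = x := by
  simpa using galoisMap_inv_cancel γ⁻¹ x

/-- Any two isomorphisms `Fs ⊗ A ≃ M_d(Fs)` give the same trace. -/
theorem trace_splitting_eq {d : ℕ} (α β : (Fs ⊗[F] A) ≃ₐ[Fs] Matrix (Fin d) (Fin d) Fs)
    (x : Fs ⊗[F] A) : Matrix.trace (α x) = Matrix.trace (β x) := by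
  simpa using Matrix.trace_map (β.symm.trans α) (β x)

/-- The conjugate `γ ∘ α ∘ γ⁻¹` of a splitting of `A_s`. -/
def conjSplitting {d : ℕ} (γ : Gal(Fs/F))
    (α : (Fs ⊗[F] A) ≃ₐ[Fs] Matrix (Fin d) (Fin d) Fs) :
    (Fs ⊗[F] A) ≃ₐ[Fs] Matrix (Fin d) (Fin d) Fs :=
  AlgEquiv.ofBijective
    (AlgHom.ofLinearMap
      { toFun := fun x => (α (galoisMap A γ⁻¹ x)).map γ
        map_add' := fun x y => by
          ext i j
          simp
        map_smul' := fun c x => by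
          ext i j
          simp [galoisMap_smul] }
      (by simp)
      (fun x y => by simp [Matrix.map_mul]))
    (by
      constructor
      · intro x y h
        have h1 : (α (galoisMap A γ⁻¹ x)).map γ = (α (galoisMap A γ⁻¹ y)).map γ := h
        have h2 := α.injective (Matrix.map_injective γ.injective h1)
        rw [← galoisMap_inv_cancel γ x, h2, galoisMap_inv_cancel]
      · intro M
        refine ⟨galoisMap A γ (α.symm (M.map γ.symm)), ?_⟩
        change (α (galoisMap A γ⁻¹ (galoisMap A γ (α.symm (M.map γ.symm))))).map γ = M
        rw [galoisMap_inv_cancel']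
        ext i j
        simp)

theorem trace_splitting_mem [IsSepClosure F Fs] {d : ℕ}
    (α : (Fs ⊗[F] A) ≃ₐ[Fs] Matrix (Fin d) (Fin d) Fs) (a : A) :
    ∃ t : F, algebraMap F Fs t = Matrix.trace (α (1 ⊗ₜ[F] a)) := by
  have : IsGalois F Fs := IsSepClosure.isGalois
  have key := (InfiniteGalois.mem_range_algebraMap_iff_fixed (k := F) (K := Fs)
    (Matrix.trace (α (1 ⊗ₜ[F] a)))).2 (fun γ => by
      have h := trace_splitting_eq (conjSplitting γ α) α (1 ⊗ₜ[F] a)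
      have h' : conjSplitting γ α (1 ⊗ₜ[F] a) = (α (galoisMap A γ⁻¹ (1 ⊗ₜ[F] a))).map γ := rfl
      rw [h', galoisMap_tmul, map_one] at h
      exact (AddMonoidHom.map_trace (γ : Fs →+* Fs) (α (1 ⊗ₜ[F] a))).trans h)
  exact key

/-- The reduced trace of a central simple algebra exists (and takes its values in `F`). -/
theorem exists_reducedTrace [IsSepClosure F Fs] {d : ℕ} (hA : IsCentralSimpleOfDegree F Fs A d) :
    ∃ t : A →ₗ[F] F, ∀ (α : (Fs ⊗[F] A) ≃ₐ[Fs] Matrix (Fin d) (Fin d) Fs) (a : A),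
      algebraMap F Fs (t a) = Matrix.trace (α (1 ⊗ₜ[F] a)) := by
  obtain ⟨-, ⟨α⟩⟩ := hA
  choose t ht using trace_splitting_mem α
  have hinj := (algebraMap F Fs).injective
  refine ⟨⟨⟨t, fun a b => hinj ?_⟩, fun c a => hinj ?_⟩, fun β a => ?_⟩
  · rw [map_add, ht, ht, ht, TensorProduct.tmul_add, map_add, Matrix.trace_add]
  · rw [smul_eq_mul, map_mul, ht, RingHom.id_apply, TensorProduct.tmul_smul,
      ← algebraMap_smul Fs c, map_smul, Matrix.trace_smul, ht, smul_eq_mul]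
  · exact (ht a).trans (trace_splitting_eq α β _)

/-- The reduced trace `Trd_A : A → F` of a central simple algebra of degree `d`. -/
def reducedTrace [IsSepClosure F Fs] {d : ℕ} (hA : IsCentralSimpleOfDegree F Fs A d) :
    A →ₗ[F] F :=
  (exists_reducedTrace hA).choose

/-- The defining property of the reduced trace, for every splitting `α` of `A_s`. -/
theorem algebraMap_reducedTrace [IsSepClosure F Fs] {d : ℕ}
    (hA : IsCentralSimpleOfDegree F Fs A d)
    (α : (Fs ⊗[F] A) ≃ₐ[Fs] Matrix (Fin d) (Fin d) Fs) (a : A) :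
    algebraMap F Fs (reducedTrace hA a) = Matrix.trace (α (1 ⊗ₜ[F] a)) :=
  (exists_reducedTrace hA).choose_spec α a

end CentralSimple

section SeveriBrauer

variable (F Fs : Type*) [Field F] [Field Fs] [Algebra F Fs]
variable (A : Type*) [Ring A] [Algebra F A]

/-- A right ideal of `A_s`, given as an `Fs`-subspace. -/
def IsRightIdeal {F Fs A : Type*} [Field F] [Field Fs] [Algebra F Fs] [Ring A] [Algebra F A]
    (I : Submodule Fs (Fs ⊗[F] A)) : Prop :=
  ∀ x ∈ I, ∀ a : Fs ⊗[F] A, x * a ∈ I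

/-- The points of the Severi--Brauer variety `SB(A)` of an algebra of degree `d`: the
`d`-dimensional right ideals of `A_s`. -/
structure SeveriBrauer (d : ℕ) where
  ideal : Submodule Fs (Fs ⊗[F] A)
  isRightIdeal : IsRightIdeal ideal
  finrank_eq : Module.finrank Fs ideal = d

variable {F Fs A}

/-- The action of the Galois group on subspaces of `A_s`: the image `γ(I)` of `I`. -/
def galoisConj (γ : Gal(Fs/F)) (I : Submodule Fs (Fs ⊗[F] A)) : Submodule Fs (Fs ⊗[F] A) where
  carrier := galoisMap A γ '' I
  zero_mem' := ⟨0, I.zero_mem, map_zero _⟩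
  add_mem' := by
    rintro _ _ ⟨x, hx, rfl⟩ ⟨y, hy, rfl⟩
    exact ⟨x + y, I.add_mem hx hy, map_add _ _ _⟩
  smul_mem' := by
    rintro c _ ⟨x, hx, rfl⟩
    refine ⟨γ.symm c • x, I.smul_mem _ hx, ?_⟩
    rw [galoisMap_smul, AlgEquiv.apply_symm_apply]

/-- A general embedding `Y ↪ SB(A)` of a `Γ`-set: an injective equivariant map whose image is not
contained in a proper linear subvariety (linear subvarieties are right ideals of `A_s`, and the
subvariety spanned by a set of points is their sum). -/
structure IsGeneralEmbedding {Y : Type*} [MulAction Gal(Fs/F) Y] {d : ℕ}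
    (ε : Y → SeveriBrauer F Fs A d) : Prop where
  injective : Function.Injective ε
  equivariant : ∀ (γ : Gal(Fs/F)) (y : Y), (ε (γ • y)).ideal = galoisConj γ (ε y).ideal
  span_eq_top : (⨆ y, (ε y).ideal) = ⊤

/-- The subalgebra `L_s = {x ∈ A_s | x · I ⊆ I for all I ∈ ε(Y)}` of `A_s`. -/
def stabilizerAlgebra {Y : Type*} {d : ℕ} (ε : Y → SeveriBrauer F Fs A d) :
    Subalgebra Fs (Fs ⊗[F] A) where
  carrier := {x | ∀ y, ∀ z ∈ (ε y).ideal, x * z ∈ (ε y).ideal}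
  mul_mem' := fun {a b} ha hb y z hz => by
    rw [mul_assoc]
    exact ha y _ (hb y z hz)
  add_mem' := fun {a b} ha hb y z hz => by
    rw [add_mul]
    exact (ε y).ideal.add_mem (ha y z hz) (hb y z hz)
  algebraMap_mem' := fun c y z hz => by
    rw [← Algebra.smul_def]
    exact (ε y).ideal.smul_mem c hz

/-- The subalgebra `L` of `A` consisting of the elements of `L_s` fixed under the Galois group,
where `A` is identified with the subset `1 ⊗ A` of all fixed elements of `A_s`
(see `mem_stabilizerAlgebra_and_fixed_iff`). -/
def embeddedAlgebra {Y : Type*} {d : ℕ} (ε : Y → SeveriBrauer F Fs A d) : Subalgebra F A :=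
  ((stabilizerAlgebra ε).restrictScalars F).comap Algebra.TensorProduct.includeRight

theorem fixed_iff [IsSepClosure F Fs] (x : Fs ⊗[F] A) :
    (∀ γ : Gal(Fs/F), galoisMap A γ x = x) ↔ ∃ a : A, 1 ⊗ₜ[F] a = x := by
  have : IsGalois F Fs := IsSepClosure.isGalois
  constructor
  · intro h
    let b := Module.Basis.ofVectorSpace F A
    let B := b.baseChange Fs
    have hrepr : ∀ (γ : Gal(Fs/F)) (z : Fs ⊗[F] A) i,
        B.repr (galoisMap A γ z) i = γ (B.repr z i) := by
      intro γ z i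
      induction z with
      | zero => simp
      | tmul c a => simp [B, Algebra.smul_def]
      | add z w hz hw => simp [hz, hw]
    have hF : ∀ i, ∃ t : F, algebraMap F Fs t = B.repr x i := fun i =>
      (InfiniteGalois.mem_range_algebraMap_iff_fixed (k := F) (K := Fs) (B.repr x i)).2
        (fun γ => by rw [← hrepr, h γ])
    choose t ht using hF
    refine ⟨∑ i ∈ (B.repr x).support, t i • b i, ?_⟩
    conv_rhs => rw [← B.linearCombination_repr x, Finsupp.linearCombination_apply, Finsupp.sum]
    rw [TensorProduct.tmul_sum]
    refine Finset.sum_congr rfl fun i _ => ?_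
    rw [← ht i, algebraMap_smul, TensorProduct.tmul_smul]
    simp [B]
  · rintro ⟨a, rfl⟩ γ
    simp

theorem mem_stabilizerAlgebra_and_fixed_iff [IsSepClosure F Fs] {Y : Type*} {d : ℕ}
    (ε : Y → SeveriBrauer F Fs A d) (x : Fs ⊗[F] A) :
    (x ∈ stabilizerAlgebra ε ∧ ∀ γ : Gal(Fs/F), galoisMap A γ x = x) ↔
      ∃ a ∈ embeddedAlgebra ε, 1 ⊗ₜ[F] a = x := by
  rw [fixed_iff]
  constructor
  · rintro ⟨hx, a, rfl⟩
    exact ⟨a, hx, rfl⟩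
  · rintro ⟨a, ha, rfl⟩
    exact ⟨ha, a, rfl⟩

end SeveriBrauer

section Etale

variable (F Fs : Type*) [Field F] [Field Fs] [Algebra F Fs]

/-- `L` is an étale `F`-algebra of dimension `m`: a finite-dimensional commutative `F`-algebra
with `Fs ⊗ L ≅ Fs × ⋯ × Fs` (`m` factors). -/
structure IsEtaleOfDim (L : Type*) [Ring L] [Algebra F L] (m : ℕ) : Prop where
  comm : ∀ x y : L, x * y = y * x
  finite : Module.Finite F L
  split : Nonempty ((Fs ⊗[F] L) ≃ₐ[Fs] (Fin m → Fs))

/-- The involutions of an étale algebra `L`: automorphisms `s` of order `2` such that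
the induced automorphism `ξ ↦ ξ ∘ s` of the set `X(L)` of algebra homomorphisms `L → Fs` has
no fixed point. -/
structure IsEtaleInvolution {L : Type*} [Ring L] [Algebra F L] (s : L →ₐ[F] L) : Prop where
  involutive : Function.Involutive s
  fixedPointFree : ∀ ξ : L →ₐ[F] Fs, ξ.comp s ≠ ξ

variable {F Fs}

/-- The right ideal `ε_*(ξ) = {x ∈ A_s | ξ(ℓ) x = ε(ℓ) x for all ℓ ∈ L}` attached to an algebra
homomorphism `ε : L → A` and a point `ξ ∈ X(L)`. -/
def pointIdeal {A : Type*} [Ring A] [Algebra F A] {L : Type*} [Ring L] [Algebra F L]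
    (ε : L →ₐ[F] A) (ξ : L →ₐ[F] Fs) : Submodule Fs (Fs ⊗[F] A) where
  carrier := {x | ∀ l : L, ξ l • x = (1 ⊗ₜ[F] ε l) * x}
  zero_mem' := fun l => by simp
  add_mem' := fun {x y} hx hy l => by rw [smul_add, mul_add, hx l, hy l]
  smul_mem' := fun c x hx l => by rw [smul_comm, hx l, mul_smul_comm]

end Etale

section QuadraticPair

/-- The symmetric elements of a linear endomorphism `σ` (in practice, an involution). -/
def sym {R B : Type*} [CommRing R] [Ring B] [Algebra R B] (σ : B →ₗ[R] B) : Submodule R B :=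
  LinearMap.eqLocus σ LinearMap.id

variable {F Fs : Type*} [Field F] [Field Fs] [Algebra F Fs] [IsSepClosure F Fs]
variable {A : Type*} [Ring A] [Algebra F A] {n : ℕ}

theorem add_mem_sym {R B : Type*} [CommRing R] [Ring B] [Algebra R B] {σ : B →ₗ[R] B}
    (h : Function.Involutive σ) (x : B) : x + σ x ∈ sym σ := by
  change σ (x + σ x) = x + σ x
  rw [map_add, h x, add_comm]

/-- A quadratic pair `(σ, f)` on a central simple `F`-algebra of degree `2n`. -/
structure QuadraticPair (hA : IsCentralSimpleOfDegree F Fs A (2 * n)) where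
  σ : A →ₗ[F] A
  map_mul : ∀ x y, σ (x * y) = σ y * σ x
  involutive : Function.Involutive σ
  f : sym σ →ₗ[F] F
  finrank_sym : Module.finrank F (sym σ) = n * (2 * n + 1)
  trd_skew : ∀ x, σ x = -x → reducedTrace hA x = 0
  f_add : ∀ x, f ⟨x + σ x, add_mem_sym involutive x⟩ = reducedTrace hA x

variable {hA : IsCentralSimpleOfDegree F Fs A (2 * n)}

namespace QuadraticPair

/-- The involution `σ_s` of `A_s` extending `σ`. -/
def σs (q : QuadraticPair hA) : (Fs ⊗[F] A) →ₗ[Fs] (Fs ⊗[F] A) :=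
  q.σ.baseChange Fs

theorem sym_σs (q : QuadraticPair hA) :
    sym q.σs = LinearMap.eqLocus (TensorProduct.AlgebraTensorModule.lTensor Fs Fs q.σ)
      (TensorProduct.AlgebraTensorModule.lTensor Fs Fs LinearMap.id) := by
  rw [TensorProduct.AlgebraTensorModule.lTensor_id]
  rfl

/-- The canonical isomorphism `Fs ⊗ Sym(A, σ) ≃ Sym(A_s, σ_s)`. -/
def symEquiv (q : QuadraticPair hA) : (Fs ⊗[F] sym q.σ) ≃ₗ[Fs] sym q.σs :=
  (LinearMap.tensorEqLocusEquiv Fs Fs q.σ LinearMap.id).trans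
    (LinearEquiv.ofEq _ _ q.sym_σs.symm)

/-- The linear form `f_s` on `Sym(A_s, σ_s)` extending `f`. -/
def fs (q : QuadraticPair hA) : sym q.σs →ₗ[Fs] Fs :=
  (TensorProduct.AlgebraTensorModule.rid F Fs Fs).toLinearMap ∘ₗ
    q.f.baseChange Fs ∘ₗ q.symEquiv.symm.toLinearMap

theorem one_tmul_mem_sym (q : QuadraticPair hA) (x : sym q.σ) :
    (1 : Fs) ⊗ₜ[F] (x : A) ∈ sym q.σs := by
  have hx : q.σ x = x := x.2
  change q.σs _ = _
  simp [σs, hx]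

theorem fs_one_tmul (q : QuadraticPair hA) (x : sym q.σ) :
    q.fs ⟨1 ⊗ₜ[F] (x : A), q.one_tmul_mem_sym x⟩ = algebraMap F Fs (q.f x) := by
  have h : q.symEquiv (1 ⊗ₜ[F] x) = ⟨1 ⊗ₜ[F] (x : A), q.one_tmul_mem_sym x⟩ := by
    apply Subtype.ext
    rfl
  rw [← h]
  simp [fs, Algebra.smul_def]

/-- A right ideal `I` of `A_s` is isotropic for `(σ_s, f_s)` if `σ_s(I) · I = 0` and `f_s` vanishes
on `I ∩ Sym(σ_s)`. -/
def IsIsotropic (q : QuadraticPair hA) (I : Submodule Fs (Fs ⊗[F] A)) : Prop :=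
  (∀ x ∈ I, ∀ y ∈ I, q.σs x * y = 0) ∧ ∀ x : sym q.σs, (x : Fs ⊗[F] A) ∈ I → q.fs x = 0

/-- The quadric `Q(σ, f) ⊆ SB(A)`: its points are the isotropic `2n`-dimensional right ideals. -/
def quadric (q : QuadraticPair hA) : Set (SeveriBrauer F Fs A (2 * n)) :=
  {p | q.IsIsotropic p.ideal}

/-- The linear subvariety of `SB(A)` given by a right ideal `I` of `A_s` lies in the quadric
`Q(σ, f)`: all its points do. -/
def LiesInQuadric (q : QuadraticPair hA) (I : Submodule Fs (Fs ⊗[F] A)) : Prop :=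
  ∀ p : SeveriBrauer F Fs A (2 * n), p.ideal ≤ I → p ∈ q.quadric

end QuadraticPair

/-- An involution of a `Γ`-set: an automorphism of order `2` without fixed points. -/
structure IsGammaInvolution {Γ Y : Type*} [Group Γ] [MulAction Γ Y] (φ : Y → Y) : Prop where
  equivariant : ∀ (γ : Γ) (y : Y), φ (γ • y) = γ • φ y
  involutive : Function.Involutive φ
  fixedPointFree : ∀ y, φ y ≠ y

/-- An embedding of quadrics `(Y, φ) ↪ Q(σ, f)`: a general embedding `Y ↪ SB(A)` that carries
isotropic linear subvarieties of `(Y, φ)` (subsets of `Y` that contain no pair `{y, φ y}`) to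
linear subvarieties of `SB(A)` that lie in `Q(σ, f)`. -/
structure IsQuadricEmbedding {Y : Type*} [MulAction Gal(Fs/F) Y] (φ : Y → Y)
    (q : QuadraticPair hA) (ε : Y → SeveriBrauer F Fs A (2 * n)) : Prop
    extends IsGeneralEmbedding ε where
  isotropic : ∀ S : Set Y, (∀ y ∈ S, φ y ∉ S) → q.LiesInQuadric (⨆ y ∈ S, (ε y).ideal)

/-- An embedding of algebras with involution `(L, s) ↪ (A, σ, f)`. -/
structure IsInvolutionEmbedding {L : Type*} [Ring L] [Algebra F L] (s : L →ₐ[F] L)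
    (q : QuadraticPair hA) (ε : L →ₐ[F] A) : Prop where
  injective : Function.Injective ε
  comm : ∀ l, ε (s l) = q.σ (ε l)
  trace : ∀ l, l + s l = 1 → ∀ x : sym q.σ, q.f x = reducedTrace hA (ε l * x)

end QuadraticPair

end QuadricEmbedding

end

open QuadricEmbedding

/-! Over `Fs` choose a splitting of `A_s` as a matrix algebra. A right ideal of minimal positive
dimension consists of the matrices whose columns are multiples of one vector; since the `2n` ideals
`ε(y)` span `A_s`, their vectors form a basis, and after conjugation `ε(y)` is the set of matrices
supported in row `e y` (`exists_isAdaptedSplitting`). Then `L_s` is the algebra of diagonal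
matrices. It is Galois stable, so by descent (`mem_span_fixed_of_stable`) it is spanned by `L`,
whence `Fs ⊗ L ≅ Fs^{2n}`. The diagonal entries are the characters of `L`; they give `θ`, and the
equation defining `θ(y)` cuts out exactly row `e y`.

For the involution, Skolem–Noether gives `σ_s(x) = J⁻¹ xᵀ J`, and the dimension of `Sym` makes `J`
symmetric, so symmetric elements are the products `S J` with `S` symmetric. Restricted to rank one
elements `v vᵀ J`, `f_s` is a quadratic form in `v` with polar form `J`. It vanishes at the basis
vectors and at sums of two basis vectors not exchanged by `φ`; hence `J` is zero outside the
positions `(y, φ(y))`. Therefore `σ_s` permutes diagonal entries through `φ`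
(`apply_diagonal_of_monomial`), and the values of `f_s` on the basis together with `f(x + σ(x)) =
Trd(x)` determine `f_s` completely (`apply_eq_trace_diagonal_mul`). Everything then restricts to
`L`. -/

namespace QuadricEmbedding

/-! ### Right ideals and involutions of a matrix algebra -/

section Matrices

open Matrix

variable {K : Type*} [Field K] {ι : Type*} [Fintype ι] [DecidableEq ι]

/-- If `v` is a nonzero column of some matrix in `I`, right multiplication produces every `v wᵀ`;
these already fill a space of dimension `card ι`. -/
theorem exists_mem_iff_vecMulVec [Nonempty ι] (I : Submodule K (Matrix ι ι K))
    (hI : ∀ x ∈ I, ∀ a : Matrix ι ι K, x * a ∈ I) (h : Module.finrank K I = Fintype.card ι) :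
    ∃ v : ι → K, ∀ x, x ∈ I ↔ ∃ w, x = vecMulVec v w := by
  have hne : I ≠ ⊥ := by
    rintro rfl
    rw [finrank_bot] at h
    exact Fintype.card_ne_zero h.symm
  obtain ⟨M, hM, hM0⟩ := I.exists_mem_ne_zero_of_ne_bot hne
  obtain ⟨i₀, j₀, hij⟩ : ∃ i j, M i j ≠ 0 := by
    by_contra! hcon
    exact hM0 (by ext i j; exact hcon i j)
  let v : ι → K := fun i => M i j₀
  let ψ : (ι → K) →ₗ[K] Matrix ι ι K :=
    { toFun := fun w => vecMulVec v w
      map_add' := fun w w' => vecMulVec_add _ _ _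
      map_smul' := fun c w => vecMulVec_smul _ _ _ }
  have hψ : Function.Injective ψ := by
    intro w w' hw
    funext j
    have h1 : v i₀ * w j = v i₀ * w' j := congrFun (congrFun hw i₀) j
    exact mul_left_cancel₀ hij h1
  have hle : LinearMap.range ψ ≤ I := by
    rintro _ ⟨w, rfl⟩
    have h1 := hI M hM (vecMulVec (Pi.single j₀ 1) w)
    rw [mul_vecMulVec, mulVec_single_one] at h1
    exact h1
  have heq : LinearMap.range ψ = I := by
    apply Submodule.eq_of_le_of_finrank_eq hle
    rw [LinearMap.finrank_range_of_inj hψ, h, Module.finrank_fintype_fun_eq_card]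
  refine ⟨v, fun x => ?_⟩
  rw [← heq]
  exact ⟨fun ⟨w, hw⟩ => ⟨w, hw.symm⟩, fun ⟨w, hw⟩ => ⟨w, hw.symm⟩⟩

/-- All the ideals lie in `P · M(K)`, where `P` has columns `v i`; if they span everything, then `1
= P X`. -/
theorem isUnit_of_iSup_eq_top (I : ι → Submodule K (Matrix ι ι K)) (v : ι → ι → K)
    (hI : ∀ i, ∀ x ∈ I i, ∃ w, x = vecMulVec (v i) w) (h : (⨆ i, I i) = ⊤) :
    IsUnit (of v)ᵀ := by
  have hle : (⨆ i, I i) ≤ LinearMap.range (LinearMap.mulLeft K (of v)ᵀ) := by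
    refine iSup_le fun i x hx => ?_
    obtain ⟨w, rfl⟩ := hI i x hx
    refine ⟨vecMulVec (Pi.single i 1) w, ?_⟩
    rw [LinearMap.mulLeft_apply, mul_vecMulVec, mulVec_single_one]
    rfl
  rw [h] at hle
  obtain ⟨X, hX⟩ := hle (Submodule.mem_top (x := 1))
  exact IsUnit.of_mul_eq_one X hX

/-- Composed with transposition, `τ` becomes an algebra automorphism, which is inner by
Skolem–Noether. -/
theorem exists_antiautomorphism_eq (τ : Matrix ι ι K →ₗ[K] Matrix ι ι K)
    (hmul : ∀ x y, τ (x * y) = τ y * τ x) (hinv : Function.Involutive τ) :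
    ∃ J G : Matrix ι ι K, J * G = 1 ∧ G * J = 1 ∧ ∀ x, τ x = G * xᵀ * J := by
  have h1 : τ 1 = 1 := by
    have h := hmul (τ 1) 1
    rw [mul_one, hinv, mul_one] at h
    exact h.symm
  let f₀ : Matrix ι ι K →ₐ[K] Matrix ι ι K :=
    AlgHom.ofLinearMap (τ ∘ₗ (transposeLinearEquiv ι ι K K).toLinearMap)
      (by simpa using h1) (fun x y => by simp [hmul])
  have hf₀ : Function.Bijective f₀ := by
    have h2 : (f₀ : Matrix ι ι K → Matrix ι ι K) = τ ∘ transpose := rfl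
    rw [h2]
    exact hinv.bijective.comp (Function.Involutive.bijective transpose_transpose)
  let f := AlgEquiv.ofBijective f₀ hf₀
  obtain ⟨T, hT⟩ := ((Matrix.toLinAlgEquiv' (R := K) (n := ι)).symm.trans
    (f.trans Matrix.toLinAlgEquiv')).eq_linearEquivConjAlgEquiv
  have key : ∀ x, f x = LinearMap.toMatrix' T.toLinearMap * x *
      LinearMap.toMatrix' T.symm.toLinearMap := by
    intro x
    have h3 := congrArg LinearMap.toMatrix' (DFunLike.congr_fun hT (Matrix.toLin' x))
    rw [LinearEquiv.conjAlgEquiv_apply] at h3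
    rw [LinearMap.toMatrix'_comp, LinearMap.toMatrix'_comp, LinearMap.toMatrix'_toLin'] at h3
    rw [← mul_assoc] at h3
    rw [← h3]
    simp only [AlgEquiv.trans_apply]
    have h4 : (Matrix.toLinAlgEquiv' (R := K) (n := ι)).symm (Matrix.toLin' x) = x :=
      LinearMap.toMatrix'_toLin' x
    rw [h4]
    exact (LinearMap.toMatrix'_toLin' (f x)).symm
  refine ⟨LinearMap.toMatrix' T.symm.toLinearMap, LinearMap.toMatrix' T.toLinearMap, ?_, ?_,
    fun x => ?_⟩
  · rw [← LinearMap.toMatrix'_comp]; simp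
  · rw [← LinearMap.toMatrix'_comp]; simp
  · rw [← key]
    change τ x = τ xᵀᵀ
    rw [transpose_transpose]

/-- The identity `τ² = id` makes `G Jᵀ` central, so `Jᵀ = c J`; transposing twice gives `c² = 1`. -/
theorem exists_transpose_eq_smul {τ : Matrix ι ι K →ₗ[K] Matrix ι ι K}
    (hinv : Function.Involutive τ) {J G : Matrix ι ι K} (hJG : J * G = 1) (hGJ : G * J = 1)
    (h : ∀ x, τ x = G * xᵀ * J) : Jᵀ = J ∨ Jᵀ = -J := by
  cases isEmpty_or_nonempty ι with
  | inl _ => exact Or.inl (Subsingleton.elim _ _)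
  | inr _ =>
    have hGJt : Gᵀ * Jᵀ = 1 := by rw [← transpose_mul, hJG, transpose_one]
    have hcomm : ∀ x, (G * Jᵀ) * x = x * (G * Jᵀ) := by
      intro x
      have h1 := hinv x
      rw [h, h, transpose_mul, transpose_mul, transpose_transpose] at h1
      calc (G * Jᵀ) * x = (G * Jᵀ) * x * (Gᵀ * Jᵀ) := by rw [hGJt, mul_one]
        _ = (G * Jᵀ) * x * Gᵀ * (J * G) * Jᵀ := by rw [hJG]; simp only [mul_assoc, one_mul]
        _ = (G * (Jᵀ * (x * Gᵀ)) * J) * G * Jᵀ := by simp only [mul_assoc]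
        _ = x * (G * Jᵀ) := by rw [h1, mul_assoc]
    obtain ⟨c, hc⟩ := mem_range_scalar_of_commute_single (M := G * Jᵀ)
      (fun i j _ => (hcomm _).symm)
    have hJt : Jᵀ = c • J := by
      calc Jᵀ = J * (G * Jᵀ) := by rw [← mul_assoc, hJG, one_mul]
        _ = c • J := by rw [← hc, scalar_apply]; ext i j; simp [mul_comm]
    have hJ0 : J ≠ 0 := by
      rintro rfl
      rw [zero_mul] at hJG
      exact zero_ne_one hJG
    have hcc : (c * c - 1) • J = 0 := by
      have h2 := congrArg transpose hJt
      rw [transpose_transpose, transpose_smul, hJt, smul_smul] at h2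
      rw [sub_smul, one_smul, ← h2, sub_self]
    have h3 : (c - 1) * (c + 1) = 0 := by
      have h4 := (smul_eq_zero.1 hcc).resolve_right hJ0
      linear_combination h4
    rcases mul_eq_zero.1 h3 with h4 | h4
    · left; rw [hJt, sub_eq_zero.1 h4, one_smul]
    · right; rw [hJt, eq_neg_of_add_eq_zero_left h4, neg_one_smul]

omit [DecidableEq ι] in
theorem two_mul_finrank_le_of_skew [LinearOrder ι] (h2 : (2 : K) ≠ 0)
    (W : Submodule K (Matrix ι ι K)) (hW : ∀ M ∈ W, Mᵀ = -M) :
    2 * Module.finrank K W ≤ Fintype.card ι * Fintype.card ι := by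
  -- Two skew matrices fit into one: the first in the strict upper triangle, the second below.
  -- Nothing is lost, since skew matrices have zero diagonal when `2 ≠ 0`.
  let ψ : (W × W) →ₗ[K] Matrix ι ι K :=
    { toFun := fun p => of fun i j => if i < j then p.1.1 i j else p.2.1 i j
      map_add' := fun p p' => by ext i j; by_cases h : i < j <;> simp [h]
      map_smul' := fun c p => by ext i j; by_cases h : i < j <;> simp [h] }
  have hskew : ∀ M ∈ W, ∀ i j, M j i = -M i j := fun M hM i j => congrFun (congrFun (hW M hM) i) j
  have hdiag : ∀ M ∈ W, ∀ i, M i i = 0 := fun M hM i => by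
    have h := hskew M hM i i
    have h' : 2 * M i i = 0 := by linear_combination h
    exact (mul_eq_zero.1 h').resolve_left h2
  have hψ : Function.Injective ψ := by
    rw [← LinearMap.ker_eq_bot, LinearMap.ker_eq_bot']
    rintro ⟨M, N⟩ h
    have hup : ∀ i j, i < j → M.1 i j = 0 := fun i j hij => by
      simpa [ψ, hij] using congrFun (congrFun h i) j
    have hlo : ∀ i j, j < i → N.1 i j = 0 := fun i j hij => by
      simpa [ψ, hij.le.not_gt] using congrFun (congrFun h i) j
    refine Prod.ext (Subtype.ext ?_) (Subtype.ext ?_)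
    · ext i j
      change M.1 i j = 0
      rcases lt_trichotomy i j with hij | rfl | hij
      · exact hup i j hij
      · exact hdiag _ M.2 i
      · rw [hskew _ M.2 j i, hup j i hij, neg_zero]
    · ext i j
      change N.1 i j = 0
      rcases lt_trichotomy i j with hij | rfl | hij
      · rw [hskew _ N.2 j i, hlo j i hij, neg_zero]
      · exact hdiag _ N.2 i
      · exact hlo i j hij
  have h := LinearMap.finrank_le_finrank_of_injective hψ
  rwa [Module.finrank_prod, Module.finrank_matrix, Module.finrank_self, mul_one, ← two_mul] at h

/-- For skew `J` with `2 ≠ 0`, left multiplication by `J` would embed `sym τ` into the skew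
matrices, which are too few. When `2 = 0`, skew and symmetric coincide. -/
theorem transpose_eq_self_of_finrank_sym [LinearOrder ι] {τ : Matrix ι ι K →ₗ[K] Matrix ι ι K}
    (hinv : Function.Involutive τ) {J G : Matrix ι ι K} (hJG : J * G = 1) (hGJ : G * J = 1)
    (h : ∀ x, τ x = G * xᵀ * J)
    (hdim : Fintype.card ι * Fintype.card ι < 2 * Module.finrank K (sym τ)) : Jᵀ = J := by
  rcases exists_transpose_eq_smul hinv hJG hGJ h with h1 | h1
  · exact h1
  by_cases h2 : (2 : K) = 0
  · rw [h1]
    ext i j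
    have h3 : 2 * J i j = 0 := by rw [h2, zero_mul]
    rw [neg_apply]
    linear_combination -h3
  exfalso
  have hinj : Function.Injective (LinearMap.mulLeft K J) := fun x y hxy => by
    have h3 : J * x = J * y := hxy
    rw [← one_mul x, ← hGJ, mul_assoc, h3, ← mul_assoc, hGJ, one_mul]
  have h3 := two_mul_finrank_le_of_skew h2 ((sym τ).map (LinearMap.mulLeft K J)) (by
    rintro _ ⟨x, hx, rfl⟩
    have hx' : τ x = x := hx
    rw [h] at hx'
    rw [LinearMap.mulLeft_apply, transpose_mul, h1]
    conv_rhs => rw [← hx', ← mul_assoc, ← mul_assoc, hJG, one_mul]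
    rw [mul_neg])
  rw [← (Submodule.equivMapOfInjective _ hinj (sym τ)).finrank_eq] at h3
  omega

/-! ### Quadratic pairs on matrices: `f` as a quadratic form with polar form `J` -/

section QuadraticForm

variable {τ : Matrix ι ι K →ₗ[K] Matrix ι ι K} {J G : Matrix ι ι K}

theorem apply_mul_of_transpose_eq (hGJ : G * J = 1) (h : ∀ x, τ x = G * xᵀ * J) (hJt : Jᵀ = J)
    (S : Matrix ι ι K) : τ (S * J) = Sᵀ * J := by
  rw [h, transpose_mul, hJt, ← mul_assoc, hGJ, one_mul]

theorem mul_mem_sym (hGJ : G * J = 1) (h : ∀ x, τ x = G * xᵀ * J) (hJt : Jᵀ = J)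
    {S : Matrix ι ι K} (hS : Sᵀ = S) : S * J ∈ sym τ := by
  change τ (S * J) = S * J
  rw [apply_mul_of_transpose_eq hGJ h hJt, hS]

theorem exists_eq_mul_of_mem_sym (hJG : J * G = 1) (hGJ : G * J = 1)
    (h : ∀ x, τ x = G * xᵀ * J) (hJt : Jᵀ = J) (x : sym τ) :
    ∃ S : Matrix ι ι K, Sᵀ = S ∧ (x : Matrix ι ι K) = S * J := by
  have hx : (x : Matrix ι ι K) = x * G * J := by rw [mul_assoc, hGJ, mul_one]
  refine ⟨x * G, ?_, hx⟩
  have h1 : τ (x * G * J) = x * G * J := by rw [← hx]; exact x.2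
  rw [apply_mul_of_transpose_eq hGJ h hJt] at h1
  have h2 := congrArg (· * G) h1
  simpa only [mul_assoc, hJG, mul_one] using h2

variable (f : sym τ →ₗ[K] K)

/-- Polarisation: with `s v = v vᵀ J`, the element `s (e_i + e_j) - s e_i - s e_j` equals `x + τ x`
for `x = e_j e_iᵀ J`, and `trace x = J i j`. The case `i = j` shows that the diagonal vanishes too,
in every characteristic. -/
theorem entry_eq_zero_of_isotropic (hGJ : G * J = 1) (h : ∀ x, τ x = G * xᵀ * J) (hJt : Jᵀ = J)
    (hf : ∀ (x : Matrix ι ι K) (y : sym τ), (y : Matrix ι ι K) = x + τ x → f y = trace x)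
    (i j : ι) (hi : ∀ (w : ι → K) (x : sym τ), (x : Matrix ι ι K) = vecMulVec (Pi.single i 1) w →
      f x = 0)
    (hj : ∀ (w : ι → K) (x : sym τ), (x : Matrix ι ι K) = vecMulVec (Pi.single j 1) w →
      f x = 0)
    (hij : ∀ (w : ι → K) (x : sym τ),
      (x : Matrix ι ι K) = vecMulVec (Pi.single i 1 + Pi.single j 1) w → f x = 0) :
    J i j = 0 := by
  have hsym : ∀ v : ι → K, (vecMulVec v v)ᵀ = vecMulVec v v := fun v => by
    ext a b; simp [vecMulVec_apply, mul_comm]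
  let s : (ι → K) → sym τ := fun v => ⟨vecMulVec v v * J, mul_mem_sym hGJ h hJt (hsym v)⟩
  have hs : ∀ v, (s v : Matrix ι ι K) = vecMulVec v (v ᵥ* J) := fun v => by
    simp [s, vecMulVec_mul]
  have h1 := hi _ _ (hs (Pi.single i 1))
  have h2 := hj _ _ (hs (Pi.single j 1))
  have h3 := hij _ _ (hs (Pi.single i 1 + Pi.single j 1))
  have h4 := hf (vecMulVec (Pi.single j 1) (Pi.single i 1) * J)
    (s (Pi.single i 1 + Pi.single j 1) - s (Pi.single i 1) - s (Pi.single j 1)) (by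
      rw [apply_mul_of_transpose_eq hGJ h hJt, transpose_vecMulVec]
      simp only [s, Submodule.coe_sub, add_vecMulVec, vecMulVec_add, add_mul]
      abel)
  rw [map_sub, map_sub, h1, h2, h3, sub_zero, sub_zero, vecMulVec_mul, trace_vecMulVec,
    single_one_dotProduct, single_one_vecMul] at h4
  exact h4.symm

variable {π : ι → ι}

theorem apply_diagonal_of_monomial (hGJ : G * J = 1)
    (h : ∀ x, τ x = G * xᵀ * J) (hJ : ∀ i j, j ≠ π i → J i j = 0)
    (hπ : Function.Involutive π) (c : ι → K) :
    τ (diagonal c) = diagonal (c ∘ π) := by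
  have hc : diagonal c * J = J * diagonal (c ∘ π) := by
    ext i j
    rw [diagonal_mul, mul_diagonal, Function.comp_apply]
    by_cases hij : j = π i
    · rw [hij, hπ i, mul_comm]
    · rw [hJ i j hij, mul_zero, zero_mul]
  rw [h, diagonal_transpose, mul_assoc, hc, ← mul_assoc, hGJ, one_mul]

/-- Split `S` as `U + Uᵀ` plus its diagonal, `U` strictly upper triangular. Each diagonal term times
`J` is supported in one row, where `f` vanishes. The rest contributes `trace (U J)`, which is zero
because `S` vanishes wherever the monomial `J` could pair with it. -/
theorem apply_eq_zero_of_hollow [LinearOrder ι] (hGJ : G * J = 1) (h : ∀ x, τ x = G * xᵀ * J)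
    (hJt : Jᵀ = J)
    (hf : ∀ (x : Matrix ι ι K) (y : sym τ), (y : Matrix ι ι K) = x + τ x → f y = trace x)
    (hJ : ∀ i j, j ≠ π i → J i j = 0)
    (hi : ∀ (i : ι) (w : ι → K) (x : sym τ),
      (x : Matrix ι ι K) = vecMulVec (Pi.single i 1) w → f x = 0)
    (x : sym τ) (S : Matrix ι ι K) (hS : Sᵀ = S) (hx : (x : Matrix ι ι K) = S * J)
    (hS0 : ∀ i, S (π i) i = 0) : f x = 0 := by
  have hent : ∀ i j, S j i = S i j := fun i j => congrFun (congrFun hS i) j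
  let U : Matrix ι ι K := of fun i j => if i < j then S i j else 0
  let D : ι → Matrix ι ι K := fun i => vecMulVec (Pi.single i 1) (Pi.single i (S i i))
  have hDt : ∀ i, (D i)ᵀ = D i := fun i => by
    ext a b
    simp only [D, transpose_apply, vecMulVec_apply, Pi.single_apply]
    by_cases ha : a = i <;> by_cases hb : b = i <;> simp [ha, hb]
  have hUt : (U + Uᵀ)ᵀ = U + Uᵀ := by rw [transpose_add, transpose_transpose, add_comm]
  have hSU : S = (U + Uᵀ) + ∑ i, D i := by
    ext a b
    simp only [U, D, Matrix.add_apply, transpose_apply, of_apply, Matrix.sum_apply, vecMulVec_apply,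
      Pi.single_apply]
    rcases lt_trichotomy a b with hab | rfl | hab
    · simp [hab, hab.le.not_gt, hab.ne]
    · simp
    · simp [hab, hab.le.not_gt, hab.ne', hent a b]
  have hxs : x = ⟨(U + Uᵀ) * J, mul_mem_sym hGJ h hJt hUt⟩ +
      ∑ i, (⟨D i * J, mul_mem_sym hGJ h hJt (hDt i)⟩ : sym τ) := by
    apply Subtype.ext
    rw [hx, Submodule.coe_add, AddSubmonoidClass.coe_finsetSum]
    conv_lhs => rw [hSU, add_mul, Finset.sum_mul]
  rw [hxs, map_add, map_sum, Finset.sum_eq_zero, add_zero]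
  · rw [hf (U * J) _ (by
      rw [apply_mul_of_transpose_eq hGJ h hJt]; exact add_mul _ _ _), trace]
    refine Finset.sum_eq_zero fun i _ => ?_
    rw [diag_apply, mul_apply]
    refine Finset.sum_eq_zero fun j _ => ?_
    by_cases hij : i = π j
    · have h0 : S i j = 0 := by rw [hij]; exact hS0 j
      simp [U, h0]
    · rw [hJ j i hij, mul_zero]
  · intro i _
    refine hi i (Pi.single i (S i i) ᵥ* J) _ ?_
    simp [D, vecMulVec_mul]

/-- For `T = diagonal c * S`, the form `f` takes the value `trace (T J)` on `(T + Tᵀ) J`, which is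
the required value. The remainder `S - (T + Tᵀ)` has entry `S (π i) i * (1 - c (π i) - c i) = 0` at
`(π i, i)`, so it is handled by `apply_eq_zero_of_hollow`. -/
theorem apply_eq_trace_diagonal_mul [LinearOrder ι] (hJG : J * G = 1) (hGJ : G * J = 1)
    (h : ∀ x, τ x = G * xᵀ * J)
    (hJt : Jᵀ = J)
    (hf : ∀ (x : Matrix ι ι K) (y : sym τ), (y : Matrix ι ι K) = x + τ x → f y = trace x)
    (hJ : ∀ i j, j ≠ π i → J i j = 0)
    (hi : ∀ (i : ι) (w : ι → K) (x : sym τ),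
      (x : Matrix ι ι K) = vecMulVec (Pi.single i 1) w → f x = 0)
    (c : ι → K) (hc : ∀ i, c i + c (π i) = 1) (x : sym τ) :
    f x = trace (diagonal c * (x : Matrix ι ι K)) := by
  obtain ⟨S, hS, hx⟩ := exists_eq_mul_of_mem_sym hJG hGJ h hJt x
  have hent : ∀ i j, S j i = S i j := fun i j => congrFun (congrFun hS i) j
  let T : Matrix ι ι K := diagonal c * S
  have hTt : (T + Tᵀ)ᵀ = T + Tᵀ := by rw [transpose_add, transpose_transpose, add_comm]
  let y : sym τ := ⟨(T + Tᵀ) * J, mul_mem_sym hGJ h hJt hTt⟩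
  have hy : f y = trace (T * J) :=
    hf _ _ (by rw [apply_mul_of_transpose_eq hGJ h hJt]; exact add_mul _ _ _)
  have hxy : f (x - y) = 0 := by
    refine apply_eq_zero_of_hollow f hGJ h hJt hf hJ hi (x - y) (S - (T + Tᵀ)) ?_ ?_ ?_
    · rw [transpose_sub, hTt, hS]
    · rw [Submodule.coe_sub, hx, sub_mul]
    · intro i
      simp only [T, Matrix.sub_apply, Matrix.add_apply, transpose_apply, diagonal_mul]
      rw [hent (π i) i]
      linear_combination (-S (π i) i) * hc i
  rw [map_sub, sub_eq_zero] at hxy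
  rw [hxy, hy, hx, mul_assoc]

end QuadraticForm

end Matrices

/-! ### Galois descent for subspaces of `A_s` -/

section Descent

variable {F Fs : Type*} [Field F] [Field Fs] [Algebra F Fs] {A : Type*} [Ring A] [Algebra F A]

theorem repr_galoisMap {κ : Type*} (b : Module.Basis κ F A) (γ : Gal(Fs/F)) (z : Fs ⊗[F] A)
    (i : κ) : (b.baseChange Fs).repr (galoisMap A γ z) i = γ ((b.baseChange Fs).repr z i) := by
  induction z with
  | zero => simp
  | tmul c a => simp [Algebra.smul_def]
  | add z w hz hw => simp [hz, hw]

/-- Galois descent: a Galois-stable subspace of `A_s` is spanned by its elements in `1 ⊗ A`. -/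
theorem mem_span_fixed_of_stable [IsSepClosure F Fs] (V : Submodule Fs (Fs ⊗[F] A))
    (hV : ∀ (γ : Gal(Fs/F)), ∀ x ∈ V, galoisMap A γ x ∈ V) {x : Fs ⊗[F] A} (hx : x ∈ V) :
    x ∈ Submodule.span Fs {z | ∃ a : A, 1 ⊗ₜ[F] a = z ∧ z ∈ V} := by
  classical
  set B := (Module.Basis.ofVectorSpace F A).baseChange Fs with hB
  induction hN : (B.repr x).support.card using Nat.strong_induction_on generalizing x with
  | _ N ih =>
    subst hN
    -- Induction on the number of nonzero coordinates in a basis defined over `F`: it applies to any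
    -- vector of `V` whose support is properly contained in that of `x`.
    have smaller : ∀ z ∈ V, ∀ i, B.repr x i ≠ 0 → B.repr z i = 0 →
        (∀ j, B.repr x j = 0 → B.repr z j = 0) →
        z ∈ Submodule.span Fs {z | ∃ a : A, 1 ⊗ₜ[F] a = z ∧ z ∈ V} := by
      intro z hz i hxi hzi hsub
      refine ih _ (Finset.card_lt_card ?_) hz rfl
      rw [Finset.ssubset_iff_of_subset (fun j hj => ?_)]
      · exact ⟨i, by simpa using hxi, by simpa using hzi⟩
      · rw [Finsupp.mem_support_iff] at hj ⊢
        exact fun h => hj (hsub j h)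
    by_cases hx0 : x = 0
    · rw [hx0]; exact Submodule.zero_mem _
    obtain ⟨i₀, hi₀⟩ : ∃ i, B.repr x i ≠ 0 := by
      by_contra! hcon
      exact hx0 (B.repr.map_eq_zero_iff.1 (Finsupp.ext hcon))
    set c := B.repr x i₀ with hc
    set v := c⁻¹ • x with hv
    have hvV : v ∈ V := V.smul_mem _ hx
    have hxv : x = c • v := by rw [hv, smul_smul, mul_inv_cancel₀ hi₀, one_smul]
    have hv1 : B.repr v i₀ = 1 := by
      rw [hv, map_smul, Finsupp.smul_apply, smul_eq_mul, ← hc, inv_mul_cancel₀ hi₀]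
    have hvx : ∀ j, B.repr x j = 0 → B.repr v j = 0 := fun j hj => by
      rw [hv, map_smul, Finsupp.smul_apply, hj, smul_zero]
    rw [hxv]
    refine Submodule.smul_mem _ _ ?_
    by_cases hfix : ∀ γ : Gal(Fs/F), galoisMap A γ v = v
    · obtain ⟨a, ha⟩ := (fixed_iff v).1 hfix
      exact Submodule.subset_span ⟨a, ha, hvV⟩
    push Not at hfix
    obtain ⟨γ, hγ⟩ := hfix
    -- One coordinate of `v` is `1`, hence Galois fixed, so `w` has smaller support than `x`.
    -- Subtracting a multiple of `w` from `v` then kills a further coordinate.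
    set w := galoisMap A γ v - v with hw
    have hwV : w ∈ V := V.sub_mem (hV γ v hvV) hvV
    have hwj : ∀ j, B.repr w j = γ (B.repr v j) - B.repr v j := fun j => by
      rw [hw, map_sub, Finsupp.sub_apply, hB, repr_galoisMap]
    have hwx : ∀ j, B.repr x j = 0 → B.repr w j = 0 := fun j hj => by
      rw [hwj, hvx j hj, map_zero, sub_zero]
    have hws := smaller w hwV i₀ hi₀ (by rw [hwj, hv1, map_one, sub_self]) hwx
    obtain ⟨j, hj⟩ : ∃ j, B.repr w j ≠ 0 := by
      by_contra! hcon
      exact hγ (sub_eq_zero.1 (B.repr.map_eq_zero_iff.1 (Finsupp.ext hcon)))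
    have hu := smaller (v - (B.repr v j / B.repr w j) • w)
      (V.sub_mem hvV (V.smul_mem _ hwV)) j (fun h => hj (hwx j h))
      (by simp [hj]) (fun k hk => by simp [hvx k hk, hwx k hk])
    have h3 := Submodule.add_mem _ hu (Submodule.smul_mem _ (B.repr v j / B.repr w j) hws)
    rwa [sub_add_cancel] at h3

end Descent

/-! ### Adapted splittings, the diagonal algebra `L_s` and the characters of `L` -/

section Splitting

open Matrix

variable {F Fs : Type*} [Field F] [Field Fs] [Algebra F Fs] {A : Type*} [Ring A] [Algebra F A]
variable {d : ℕ} {Y : Type*}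

/-- A splitting `β` of `A_s` that carries each `ε(y)` to the ideal of matrices supported in the
row `e y`. -/
def IsAdaptedSplitting (ε : Y → SeveriBrauer F Fs A d)
    (β : (Fs ⊗[F] A) ≃ₐ[Fs] Matrix (Fin d) (Fin d) Fs) (e : Y ≃ Fin d) : Prop :=
  ∀ y x, x ∈ (ε y).ideal ↔ ∃ w, β x = vecMulVec (Pi.single (e y) 1) w

theorem exists_isAdaptedSplitting (hA : IsCentralSimpleOfDegree F Fs A d) [Finite Y]
    (hY : Nat.card Y = d) (ε : Y → SeveriBrauer F Fs A d) (hε : (⨆ y, (ε y).ideal) = ⊤) :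
    ∃ β e, IsAdaptedSplitting ε β e := by
  obtain ⟨hd, ⟨α⟩⟩ := hA
  have : Nonempty (Fin d) := ⟨⟨0, hd⟩⟩
  let e : Y ≃ Fin d := Finite.equivFinOfCardEq hY
  have hv : ∀ i : Fin d, ∃ v : Fin d → Fs, ∀ M,
      M ∈ (ε (e.symm i)).ideal.map α.toLinearEquiv.toLinearMap ↔ ∃ w, M = vecMulVec v w := by
    intro i
    refine exists_mem_iff_vecMulVec _ ?_ ?_
    · rintro _ ⟨x, hx, rfl⟩ a
      refine ⟨x * α.symm a, (ε (e.symm i)).isRightIdeal x hx _, ?_⟩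
      change α (x * α.symm a) = α x * a
      rw [map_mul, AlgEquiv.apply_symm_apply]
    · rw [Fintype.card_fin]
      exact (LinearEquiv.finrank_map_eq α.toLinearEquiv _).trans (ε (e.symm i)).finrank_eq
  choose v hv using hv
  have hP := isUnit_of_iSup_eq_top
    (fun i => (ε (e.symm i)).ideal.map α.toLinearEquiv.toLinearMap) v
    (fun i x hx => (hv i x).1 hx) (by
      rw [← Submodule.map_iSup, e.symm.iSup_comp (g := fun y => (ε y).ideal), hε,
        Submodule.map_top]
      exact LinearEquiv.range _)
  obtain ⟨u, hu⟩ := hP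
  -- Conjugation by the change of basis that carries `v i` to the standard vector `e_i`.
  let κ : Matrix (Fin d) (Fin d) Fs ≃ₐ[Fs] Matrix (Fin d) (Fin d) Fs :=
    MulSemiringAction.toAlgEquiv Fs _ (ConjAct.toConjAct u⁻¹)
  have hκ : ∀ M, κ M = (u⁻¹).1 * M * u.1 := fun M => by
    simp [κ, ConjAct.units_smul_def]
  have hcol : ∀ i, (u : Matrix (Fin d) (Fin d) Fs) *ᵥ Pi.single i 1 = v i := fun i => by
    rw [hu, mulVec_single_one]; rfl
  have hcol' : ∀ i, (u⁻¹).1 *ᵥ v i = Pi.single i 1 := fun i => by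
    rw [← hcol, mulVec_mulVec, Units.inv_mul, one_mulVec]
  refine ⟨α.trans κ, e, fun y x => ?_⟩
  have h1 : x ∈ (ε y).ideal ↔ ∃ w, α x = vecMulVec (v (e y)) w := by
    rw [← hv, Equiv.symm_apply_apply]
    constructor
    · exact fun h => ⟨x, h, rfl⟩
    · rintro ⟨z, hz, hzx⟩
      rwa [← α.injective hzx]
  rw [h1, AlgEquiv.trans_apply, hκ]
  constructor
  · rintro ⟨w, hw⟩
    refine ⟨w ᵥ* u.1, ?_⟩
    rw [hw, mul_vecMulVec, hcol', vecMulVec_mul]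
  · rintro ⟨w, hw⟩
    refine ⟨w ᵥ* (u⁻¹).1, ?_⟩
    have h2 := congrArg (fun M => u.1 * M * (u⁻¹).1) hw
    simp only [mul_vecMulVec, hcol, vecMulVec_mul, ← mul_assoc] at h2
    rw [← h2]
    simp [mul_assoc]

namespace IsAdaptedSplitting

variable {ε : Y → SeveriBrauer F Fs A d} {β : (Fs ⊗[F] A) ≃ₐ[Fs] Matrix (Fin d) (Fin d) Fs}
  {e : Y ≃ Fin d}

theorem mem_ideal_iff (hβ : IsAdaptedSplitting ε β e) (y : Y) (x : Fs ⊗[F] A) :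
    x ∈ (ε y).ideal ↔ ∀ i j, i ≠ e y → β x i j = 0 := by
  rw [hβ]
  constructor
  · rintro ⟨w, hw⟩ i j hij
    rw [hw, vecMulVec_apply, Pi.single_eq_of_ne hij, zero_mul]
  · intro h
    refine ⟨β x (e y), ?_⟩
    ext i j
    rw [vecMulVec_apply]
    by_cases hij : i = e y
    · simp [hij]
    · rw [h i j hij, Pi.single_eq_of_ne hij, zero_mul]

theorem mem_stabilizerAlgebra_iff (hβ : IsAdaptedSplitting ε β e) (x : Fs ⊗[F] A) :
    x ∈ stabilizerAlgebra ε ↔ ∃ c, β x = diagonal c := by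
  constructor
  · intro hx
    refine ⟨fun i => β x i i, ?_⟩
    ext i j
    by_cases hij : i = j
    · simp [hij]
    rw [diagonal_apply_ne _ hij]
    -- Test on the matrix unit `E_jj`: the product keeps column `j` of `β x`, which must lie in row
    -- `j`.
    have h1 := hx (e.symm j) (β.symm (vecMulVec (Pi.single j 1) (Pi.single j 1)))
      ((hβ _ _).2 ⟨_, by rw [AlgEquiv.apply_symm_apply, Equiv.apply_symm_apply]⟩)
    have h2 := (hβ.mem_ideal_iff _ _).1 h1 i j (by rwa [Equiv.apply_symm_apply])
    rw [map_mul, AlgEquiv.apply_symm_apply, mul_vecMulVec, mulVec_single_one] at h2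
    simpa [vecMulVec_apply] using h2
  · rintro ⟨c, hc⟩ y z hz
    rw [hβ.mem_ideal_iff] at hz ⊢
    intro i j hij
    rw [map_mul, hc, diagonal_mul, hz i j hij, mul_zero]

theorem mem_ideal_single (hβ : IsAdaptedSplitting ε β e) (y : Y) :
    β.symm (single (e y) (e y) 1) ∈ (ε y).ideal := by
  rw [hβ.mem_ideal_iff]
  intro i j hij
  rw [AlgEquiv.apply_symm_apply, single_apply_of_row_ne hij.symm]

/-- The character `ℓ ↦ θ(y)(ℓ)` through which `L` acts on `ε(y)`. -/
noncomputable def character (hβ : IsAdaptedSplitting ε β e) (y : Y) : embeddedAlgebra ε →ₐ[F] Fs :=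
  have hd : ∀ l : embeddedAlgebra ε, ∃ c, β (1 ⊗ₜ[F] (l : A)) = diagonal c :=
    fun l => (hβ.mem_stabilizerAlgebra_iff _).1 l.2
  { toFun := fun l => β (1 ⊗ₜ[F] (l : A)) (e y) (e y)
    map_one' := by
      change β 1 (e y) (e y) = 1
      simp
    map_zero' := by simp
    map_add' := fun l m => by simp [TensorProduct.tmul_add]
    map_mul' := fun l m => by
      obtain ⟨c, hc⟩ := hd l
      obtain ⟨c', hc'⟩ := hd m
      have h : (1 : Fs) ⊗ₜ[F] ((l * m : embeddedAlgebra ε) : A) =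
          (1 ⊗ₜ[F] (l : A)) * (1 ⊗ₜ[F] (m : A)) := by simp
      rw [h, map_mul, hc, hc', diagonal_mul_diagonal]
      simp
    commutes' := fun r => by
      have h : (1 : Fs) ⊗ₜ[F] ((algebraMap F (embeddedAlgebra ε) r : embeddedAlgebra ε) : A) =
          algebraMap Fs _ (algebraMap F Fs r) := by
        rw [Algebra.TensorProduct.algebraMap_apply, Subalgebra.coe_algebraMap,
          Algebra.algebraMap_eq_smul_one, Algebra.algebraMap_eq_smul_one,
          TensorProduct.tmul_smul, TensorProduct.smul_tmul', algebraMap_smul]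
      rw [h, AlgEquiv.commutes]
      simp [algebraMap_eq_diagonal] }

theorem character_apply (hβ : IsAdaptedSplitting ε β e) (y : Y) (l : embeddedAlgebra ε) :
    hβ.character y l = β (1 ⊗ₜ[F] (l : A)) (e y) (e y) := rfl

theorem apply_one_tmul (hβ : IsAdaptedSplitting ε β e) (l : embeddedAlgebra ε) :
    β (1 ⊗ₜ[F] (l : A)) = diagonal fun i => hβ.character (e.symm i) l := by
  obtain ⟨c, hc⟩ := (hβ.mem_stabilizerAlgebra_iff _).1 l.2
  have hc' : β (1 ⊗ₜ[F] (l : A)) = diagonal c := hc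
  simp [character_apply, hc']

theorem eq_of_character_eq (hβ : IsAdaptedSplitting ε β e) {l m : embeddedAlgebra ε}
    (h : ∀ y, hβ.character y l = hβ.character y m) : l = m := by
  have h1 : β (1 ⊗ₜ[F] (l : A)) = β (1 ⊗ₜ[F] (m : A)) := by
    rw [hβ.apply_one_tmul, hβ.apply_one_tmul]
    simp only [h]
  exact Subtype.ext
    (Algebra.TensorProduct.includeRight_injective (algebraMap F Fs).injective (β.injective h1))

theorem mul_comm_embeddedAlgebra (hβ : IsAdaptedSplitting ε β e) (l m : embeddedAlgebra ε) :
    l * m = m * l :=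
  hβ.eq_of_character_eq fun y => by rw [map_mul, map_mul, mul_comm]

/-- The relation is linear in `s`, and by descent `L` spans `L_s`; so it may be tested on all
diagonal matrices, including the idempotents, which need not come from `L`. -/
theorem mem_pointIdeal_iff_forall [IsSepClosure F Fs] (hβ : IsAdaptedSplitting ε β e)
    (hstab : ∀ (γ : Gal(Fs/F)), ∀ x ∈ stabilizerAlgebra ε, galoisMap A γ x ∈ stabilizerAlgebra ε)
    (y : Y) (x : Fs ⊗[F] A) :
    x ∈ pointIdeal (embeddedAlgebra ε).val (hβ.character y) ↔
      ∀ s ∈ stabilizerAlgebra ε, β s (e y) (e y) • x = s * x := by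
  constructor
  · intro hx s hs
    have h := mem_span_fixed_of_stable (Subalgebra.toSubmodule (stabilizerAlgebra ε)) hstab hs
    clear hs
    induction h using Submodule.span_induction with
    | mem z hz =>
      obtain ⟨a, rfl, ha⟩ := hz
      exact hx ⟨a, ha⟩
    | zero => simp
    | add z w _ _ hz hw => rw [map_add, Matrix.add_apply, add_smul, hz, hw, add_mul]
    | smul c z _ hz => rw [map_smul, Matrix.smul_apply, smul_assoc, hz, smul_mul_assoc]
  · exact fun h l => h _ l.2

theorem ideal_eq_pointIdeal [IsSepClosure F Fs] (hβ : IsAdaptedSplitting ε β e)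
    (hstab : ∀ (γ : Gal(Fs/F)), ∀ x ∈ stabilizerAlgebra ε, galoisMap A γ x ∈ stabilizerAlgebra ε)
    (y : Y) : (ε y).ideal = pointIdeal (embeddedAlgebra ε).val (hβ.character y) := by
  ext x
  rw [hβ.mem_pointIdeal_iff_forall hstab]
  constructor
  · intro hx s hs
    obtain ⟨c, hc⟩ := (hβ.mem_stabilizerAlgebra_iff s).1 hs
    apply β.injective
    rw [map_mul, map_smul, hc]
    ext i j
    rw [diagonal_mul, Matrix.smul_apply, diagonal_apply_eq, smul_eq_mul]
    by_cases hi : i = e y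
    · rw [hi]
    · rw [(hβ.mem_ideal_iff y x).1 hx i j hi, mul_zero, mul_zero]
  · intro hx
    -- This idempotent acts as the identity on `x`, and it annihilates every row but `e y`.
    have h := hx (β.symm (diagonal (Pi.single (e y) 1)))
      ((hβ.mem_stabilizerAlgebra_iff _).2 ⟨_, β.apply_symm_apply _⟩)
    rw [β.apply_symm_apply, diagonal_apply_eq, Pi.single_eq_same, one_smul] at h
    rw [hβ.mem_ideal_iff]
    intro i j hij
    rw [h, map_mul, β.apply_symm_apply, diagonal_mul, Pi.single_eq_of_ne hij, zero_mul]

theorem eq_character_of_ideal_eq (hβ : IsAdaptedSplitting ε β e) {y : Y}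
    {ξ : embeddedAlgebra ε →ₐ[F] Fs}
    (hξ : (ε y).ideal = pointIdeal (embeddedAlgebra ε).val ξ) : ξ = hβ.character y := by
  ext l
  have h := hβ.mem_ideal_single y
  rw [hξ] at h
  have h1 := congrFun (congrFun (congrArg β (h l)) (e y)) (e y)
  rw [map_mul, map_smul, AlgEquiv.apply_symm_apply, Subalgebra.coe_val, hβ.apply_one_tmul,
    diagonal_mul, Matrix.smul_apply, single_apply_same, Equiv.symm_apply_apply] at h1
  simpa using h1

/-- The map `Fs ⊗ L → Fs × ⋯ × Fs` with the characters of `L` as components. -/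
noncomputable def toPi (hβ : IsAdaptedSplitting ε β e) :
    (Fs ⊗[F] embeddedAlgebra ε) →ₐ[Fs] (Fin d → Fs) :=
  Algebra.TensorProduct.lift (Algebra.ofId Fs _)
    (AlgHom.pi fun i => hβ.character (e.symm i)) (fun _ _ => Commute.all _ _)

theorem toPi_tmul (hβ : IsAdaptedSplitting ε β e) (c : Fs) (l : embeddedAlgebra ε) (i : Fin d) :
    hβ.toPi (c ⊗ₜ[F] l) i = c * hβ.character (e.symm i) l := by
  simp [toPi, Algebra.ofId_apply]

theorem apply_map_val (hβ : IsAdaptedSplitting ε β e) (x : Fs ⊗[F] embeddedAlgebra ε) :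
    β (Algebra.TensorProduct.map (AlgHom.id Fs Fs) (embeddedAlgebra ε).val x) =
      diagonal (hβ.toPi x) := by
  induction x with
  | zero => simp
  | tmul c l =>
    have h : c ⊗ₜ[F] (l : A) = c • ((1 : Fs) ⊗ₜ[F] (l : A)) := by
      rw [TensorProduct.smul_tmul', smul_eq_mul, mul_one]
    rw [Algebra.TensorProduct.map_tmul, AlgHom.id_apply, Subalgebra.coe_val, h, map_smul,
      hβ.apply_one_tmul, ← diagonal_smul]
    congr 1
  | add x y hx hy => rw [map_add, map_add, hx, hy, map_add, diagonal_add]; rfl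

/-- Injectivity comes from flatness of `Fs` over `F`, surjectivity from descent for `L_s`. -/
theorem bijective_toPi [IsSepClosure F Fs] (hβ : IsAdaptedSplitting ε β e)
    (hstab : ∀ (γ : Gal(Fs/F)), ∀ x ∈ stabilizerAlgebra ε,
      galoisMap A γ x ∈ stabilizerAlgebra ε) : Function.Bijective hβ.toPi := by
  constructor
  · intro x y hxy
    have h := β.injective ((hβ.apply_map_val x).trans
      ((congrArg diagonal hxy).trans (hβ.apply_map_val y).symm))
    exact Module.Flat.lTensor_preserves_injective_linearMap (M := Fs)
      (embeddedAlgebra ε).val.toLinearMap Subtype.val_injective h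
  · intro c
    have hs : β.symm (diagonal c) ∈ stabilizerAlgebra ε :=
      (hβ.mem_stabilizerAlgebra_iff _).2 ⟨c, β.apply_symm_apply _⟩
    have h := mem_span_fixed_of_stable (Subalgebra.toSubmodule (stabilizerAlgebra ε)) hstab hs
    have hle : Submodule.span Fs {z : Fs ⊗[F] A | ∃ a : A, 1 ⊗ₜ[F] a = z ∧
        z ∈ Subalgebra.toSubmodule (stabilizerAlgebra ε)} ≤ LinearMap.range
          (Algebra.TensorProduct.map (AlgHom.id Fs Fs) (embeddedAlgebra ε).val).toLinearMap := by
      rw [Submodule.span_le]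
      rintro _ ⟨a, rfl, ha⟩
      exact ⟨1 ⊗ₜ[F] (⟨a, ha⟩ : embeddedAlgebra ε), by simp⟩
    obtain ⟨x, hx⟩ := hle h
    refine ⟨x, diagonal_injective ?_⟩
    rw [← hβ.apply_map_val]
    exact (congrArg β hx).trans (β.apply_symm_apply _)

theorem isEtaleOfDim [IsSepClosure F Fs] (hβ : IsAdaptedSplitting ε β e)
    (hstab : ∀ (γ : Gal(Fs/F)), ∀ x ∈ stabilizerAlgebra ε,
      galoisMap A γ x ∈ stabilizerAlgebra ε) : IsEtaleOfDim F Fs (embeddedAlgebra ε) d where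
  comm := hβ.mul_comm_embeddedAlgebra
  finite := by
    have : Module.Finite Fs (Fs ⊗[F] embeddedAlgebra ε) :=
      Module.Finite.equiv
        (LinearEquiv.ofBijective hβ.toPi.toLinearMap (hβ.bijective_toPi hstab)).symm
    exact Module.Finite.of_finite_tensorProduct_of_faithfullyFlat Fs
  split := ⟨AlgEquiv.ofBijective hβ.toPi (hβ.bijective_toPi hstab)⟩

theorem bijective_character [IsSepClosure F Fs] (hβ : IsAdaptedSplitting ε β e)
    (hstab : ∀ (γ : Gal(Fs/F)), ∀ x ∈ stabilizerAlgebra ε,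
      galoisMap A γ x ∈ stabilizerAlgebra ε) (hinj : Function.Injective ε) :
    Function.Bijective hβ.character := by
  constructor
  · intro y z hyz
    have h := hβ.ideal_eq_pointIdeal hstab y
    rw [hyz, ← hβ.ideal_eq_pointIdeal hstab z] at h
    apply hinj
    cases hy : ε y
    cases hz : ε z
    rw [hy, hz] at h
    cases h
    rfl
  · intro ξ
    let Ψ := AlgEquiv.ofBijective hβ.toPi (hβ.bijective_toPi hstab)
    let Ξ : (Fs ⊗[F] embeddedAlgebra ε) →ₐ[Fs] Fs :=
      Algebra.TensorProduct.lift (AlgHom.id Fs Fs) ξ (fun _ _ => Commute.all _ _)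
    -- Extended to `Fs`, a character of `L` becomes an algebra homomorphism `Fs^d → Fs`. It is
    -- nonzero on some primitive idempotent, hence is the corresponding coordinate projection.
    let χ : (Fin d → Fs) →ₐ[Fs] Fs := Ξ.comp Ψ.symm.toAlgHom
    obtain ⟨i, hi⟩ : ∃ i, χ (Pi.single i 1) ≠ 0 := by
      by_contra! hcon
      have h1 := map_one χ
      rw [← Finset.univ_sum_single (1 : Fin d → Fs), map_sum] at h1
      simp only [Pi.one_apply, hcon, Finset.sum_const_zero] at h1
      exact zero_ne_one h1
    have hχ : ∀ c, χ c = c i := by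
      intro c
      have h1 : c * Pi.single i 1 = c i • Pi.single i 1 := by
        funext j
        by_cases hj : j = i
        · rw [hj]; simp
        · simp [hj]
      have h2 := congrArg χ h1
      rw [map_mul, map_smul, smul_eq_mul] at h2
      exact mul_right_cancel₀ hi h2
    refine ⟨e.symm i, ?_⟩
    ext l
    have h1 : χ (Ψ (1 ⊗ₜ[F] l)) = ξ l := by
      simp [χ, Ξ]
    rw [← h1, hχ]
    exact ((hβ.toPi_tmul 1 l i).trans (one_mul _)).symm

end IsAdaptedSplitting

theorem galoisMap_mem_stabilizerAlgebra [MulAction Gal(Fs/F) Y] {ε : Y → SeveriBrauer F Fs A d}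
    (hε : ∀ (γ : Gal(Fs/F)) (y : Y), (ε (γ • y)).ideal = galoisConj γ (ε y).ideal)
    (γ : Gal(Fs/F)) (x : Fs ⊗[F] A) (hx : x ∈ stabilizerAlgebra ε) :
    galoisMap A γ x ∈ stabilizerAlgebra ε := by
  intro y z hz
  rw [← smul_inv_smul γ y, hε] at hz ⊢
  obtain ⟨z', hz', rfl⟩ := hz
  exact ⟨x * z', hx _ _ hz', map_mul _ _ _⟩

theorem galoisConj_pointIdeal {L : Type*} [Ring L] [Algebra F L] (ι : L →ₐ[F] A)
    (ξ : L →ₐ[F] Fs) (γ : Gal(Fs/F)) :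
    galoisConj γ (pointIdeal ι ξ) = pointIdeal ι ((γ : Fs →ₐ[F] Fs).comp ξ) := by
  have hle : ∀ (γ : Gal(Fs/F)) (ξ : L →ₐ[F] Fs), ∀ x ∈ pointIdeal ι ξ,
      galoisMap A γ x ∈ pointIdeal ι ((γ : Fs →ₐ[F] Fs).comp ξ) := by
    intro γ ξ x hx l
    have h := congrArg (galoisMap A γ) (hx l)
    rw [galoisMap_smul, map_mul, galoisMap_tmul, map_one] at h
    exact h
  ext x
  constructor
  · rintro ⟨z, hz, rfl⟩
    exact hle γ ξ z hz
  · intro hx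
    refine ⟨galoisMap A γ⁻¹ x, ?_, galoisMap_inv_cancel γ x⟩
    have h := hle γ⁻¹ _ x hx
    have hξ : ((γ⁻¹ : Gal(Fs/F)) : Fs →ₐ[F] Fs).comp ((γ : Fs →ₐ[F] Fs).comp ξ) = ξ := by
      ext l
      exact congrArg (fun g : Gal(Fs/F) => g (ξ l)) (inv_mul_cancel γ)
    rwa [hξ] at h

end Splitting

/-! ### The quadratic pair over `Fs` and its transport to matrices -/

section QuadraticPair

open Matrix

variable {F Fs : Type*} [Field F] [Field Fs] [Algebra F Fs] [IsSepClosure F Fs]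
variable {A : Type*} [Ring A] [Algebra F A] {n : ℕ}
variable {hA : IsCentralSimpleOfDegree F Fs A (2 * n)}

namespace QuadraticPair

variable (q : QuadraticPair hA)

theorem σs_mul (x y : Fs ⊗[F] A) : q.σs (x * y) = q.σs y * q.σs x := by
  induction x with
  | zero => simp
  | add x₁ x₂ h₁ h₂ => rw [add_mul, map_add, h₁, h₂, map_add, mul_add]
  | tmul c a =>
    induction y with
    | zero => simp
    | add y₁ y₂ h₁ h₂ => rw [mul_add, map_add, h₁, h₂, map_add, add_mul]
    | tmul c' a' => simp [σs, q.map_mul, mul_comm]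

theorem σs_involutive : Function.Involutive q.σs := by
  intro x
  induction x with
  | zero => simp
  | add x y hx hy => rw [map_add, map_add, hx, hy]
  | tmul c a => simp [σs, q.involutive a]

theorem finrank_sym_σs : Module.finrank Fs (sym q.σs) = n * (2 * n + 1) := by
  rw [← q.symEquiv.finrank_eq, Module.finrank_baseChange, q.finrank_sym]

theorem fs_add (β : (Fs ⊗[F] A) ≃ₐ[Fs] Matrix (Fin (2 * n)) (Fin (2 * n)) Fs)
    (x : Fs ⊗[F] A) (y : sym q.σs) (hy : (y : Fs ⊗[F] A) = x + q.σs x) :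
    q.fs y = trace (β x) := by
  obtain rfl : y = ⟨x + q.σs x, add_mem_sym q.σs_involutive x⟩ := Subtype.ext hy
  clear hy
  induction x with
  | zero =>
    have h : (⟨0 + q.σs 0, add_mem_sym q.σs_involutive 0⟩ : sym q.σs) = 0 :=
      Subtype.ext (by simp)
    rw [h]
    simp
  | add x y hx hy =>
    have h : (⟨x + y + q.σs (x + y), add_mem_sym q.σs_involutive (x + y)⟩ : sym q.σs) =
        ⟨x + q.σs x, add_mem_sym q.σs_involutive x⟩ +
          ⟨y + q.σs y, add_mem_sym q.σs_involutive y⟩ :=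
      Subtype.ext (by simp only [map_add, Submodule.coe_add]; abel)
    rw [h, map_add, hx, hy, map_add, trace_add]
  | tmul c a =>
    have h : (⟨c ⊗ₜ[F] a + q.σs (c ⊗ₜ[F] a), add_mem_sym q.σs_involutive _⟩ : sym q.σs) =
        c • ⟨1 ⊗ₜ[F] ((⟨a + q.σ a, add_mem_sym q.involutive a⟩ : sym q.σ) : A),
          q.one_tmul_mem_sym _⟩ :=
      Subtype.ext (by
        rw [Submodule.coe_smul, TensorProduct.smul_tmul', smul_eq_mul, mul_one,
          TensorProduct.tmul_add]
        rfl)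
    have h' : c ⊗ₜ[F] a = c • ((1 : Fs) ⊗ₜ[F] a) := by
      rw [TensorProduct.smul_tmul', smul_eq_mul, mul_one]
    rw [h, map_smul, q.fs_one_tmul, q.f_add, h', map_smul, trace_smul,
      algebraMap_reducedTrace hA β]

end QuadraticPair

section Transport

variable (q : QuadraticPair hA)
  (β : (Fs ⊗[F] A) ≃ₐ[Fs] Matrix (Fin (2 * n)) (Fin (2 * n)) Fs)

/-- The involution `σ_s` transported to matrices along a splitting of `A_s`. -/
noncomputable def matrixInvolution :
    Matrix (Fin (2 * n)) (Fin (2 * n)) Fs →ₗ[Fs] Matrix (Fin (2 * n)) (Fin (2 * n)) Fs :=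
  β.toLinearMap ∘ₗ q.σs ∘ₗ β.symm.toLinearMap

theorem matrixInvolution_apply (M : Matrix (Fin (2 * n)) (Fin (2 * n)) Fs) :
    matrixInvolution q β M = β (q.σs (β.symm M)) := rfl

theorem matrixInvolution_mul (M N : Matrix (Fin (2 * n)) (Fin (2 * n)) Fs) :
    matrixInvolution q β (M * N) = matrixInvolution q β N * matrixInvolution q β M := by
  simp [matrixInvolution_apply, q.σs_mul]

theorem matrixInvolution_involutive : Function.Involutive (matrixInvolution q β) := fun M => by
  simp [matrixInvolution_apply, q.σs_involutive _]

theorem symm_mem_sym {M : Matrix (Fin (2 * n)) (Fin (2 * n)) Fs}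
    (hM : M ∈ sym (matrixInvolution q β)) : β.symm M ∈ sym q.σs := by
  have h : β (q.σs (β.symm M)) = M := hM
  exact β.injective (h.trans (β.apply_symm_apply M).symm)

theorem apply_mem_sym {x : Fs ⊗[F] A} (hx : x ∈ sym q.σs) :
    β x ∈ sym (matrixInvolution q β) := by
  have h : q.σs x = x := hx
  change β (q.σs (β.symm (β x))) = β x
  rw [β.symm_apply_apply, h]

/-- The linear form `f_s` transported to matrices along a splitting of `A_s`. -/
noncomputable def matrixForm : sym (matrixInvolution q β) →ₗ[Fs] Fs :=
  q.fs ∘ₗ (β.symm.toLinearMap.restrict fun _ => symm_mem_sym q β)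

theorem matrixForm_apply (M : sym (matrixInvolution q β)) :
    matrixForm q β M = q.fs ⟨β.symm M, symm_mem_sym q β M.2⟩ := rfl

theorem lt_two_mul_finrank_sym_matrixInvolution :
    2 * n * (2 * n) < 2 * Module.finrank Fs (sym (matrixInvolution q β)) := by
  have hn : 0 < n := by
    have := hA.1
    omega
  have h : Module.finrank Fs (sym q.σs) ≤ Module.finrank Fs (sym (matrixInvolution q β)) :=
    LinearMap.finrank_le_finrank_of_injective
      (f := β.toLinearMap.restrict fun _ => apply_mem_sym q β)
      (fun x y hxy => Subtype.ext (β.injective (congrArg Subtype.val hxy)))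
  rw [q.finrank_sym_σs] at h
  -- Twice the dimension of `Sym` is `4n² + 2n`, which exceeds `4n²` because `n > 0`.
  nlinarith

theorem matrixForm_add (M : Matrix (Fin (2 * n)) (Fin (2 * n)) Fs)
    (N : sym (matrixInvolution q β))
    (hN : (N : Matrix (Fin (2 * n)) (Fin (2 * n)) Fs) = M + matrixInvolution q β M) :
    matrixForm q β N = trace M := by
  rw [matrixForm_apply, q.fs_add β (β.symm M), β.apply_symm_apply]
  simp [hN, matrixInvolution_apply]

end Transport

/-- The point of `SB(A)` corresponding to a nonzero vector under a splitting of `A_s`. -/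
noncomputable def vectorPoint {d : ℕ} (β : (Fs ⊗[F] A) ≃ₐ[Fs] Matrix (Fin d) (Fin d) Fs)
    {v : Fin d → Fs} (hv : v ≠ 0) : SeveriBrauer F Fs A d where
  ideal := LinearMap.range (β.symm.toLinearMap ∘ₗ vecMulVecBilin Fs Fs v)
  isRightIdeal := by
    rintro _ ⟨w, rfl⟩ a
    refine ⟨w ᵥ* β a, β.injective ?_⟩
    change β (β.symm (vecMulVec v (w ᵥ* β a))) = β (β.symm (vecMulVec v w) * a)
    rw [map_mul, β.apply_symm_apply, β.apply_symm_apply, vecMulVec_mul]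
  finrank_eq := by
    obtain ⟨i, hi⟩ := Function.ne_iff.1 hv
    rw [LinearMap.finrank_range_of_inj, Module.finrank_fin_fun]
    intro w w' hw
    have h : vecMulVec v w = vecMulVec v w' := β.symm.injective hw
    funext j
    exact mul_left_cancel₀ hi (congrFun (congrFun h i) j)

omit [IsSepClosure F Fs] in
theorem mem_vectorPoint {d : ℕ} (β : (Fs ⊗[F] A) ≃ₐ[Fs] Matrix (Fin d) (Fin d) Fs)
    {v : Fin d → Fs} (hv : v ≠ 0) (x : Fs ⊗[F] A) :
    x ∈ (vectorPoint β hv).ideal ↔ ∃ w, β x = vecMulVec v w := by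
  constructor
  · rintro ⟨w, rfl⟩
    exact ⟨w, β.apply_symm_apply _⟩
  · rintro ⟨w, hw⟩
    exact ⟨w, (congrArg β.symm hw).symm.trans (β.symm_apply_apply x)⟩

/-! ### Isotropy of the embedding and the involution on `L` -/

section Embedding

variable {q : QuadraticPair hA} {Y : Type*} [MulAction Gal(Fs/F) Y] {φ : Y → Y}
  {ε : Y → SeveriBrauer F Fs A (2 * n)}
  {β : (Fs ⊗[F] A) ≃ₐ[Fs] Matrix (Fin (2 * n)) (Fin (2 * n)) Fs} {e : Y ≃ Fin (2 * n)}

/-- The hypothesis on a linear subvariety speaks of its points only; `vectorPoint` supplies the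
point determined by `v`. -/
theorem matrixForm_eq_zero (hε : IsQuadricEmbedding φ q ε) (S : Set Y) (hS : ∀ y ∈ S, φ y ∉ S) {v : Fin (2 * n) → Fs} (hv : v ≠ 0)
    (hvS : ∀ w, β.symm (vecMulVec v w) ∈ ⨆ y ∈ S, (ε y).ideal) (w : Fin (2 * n) → Fs)
    (x : sym (matrixInvolution q β))
    (hx : (x : Matrix (Fin (2 * n)) (Fin (2 * n)) Fs) = vecMulVec v w) :
    matrixForm q β x = 0 := by
  have hle : (vectorPoint β hv).ideal ≤ ⨆ y ∈ S, (ε y).ideal := by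
    intro z hz
    obtain ⟨w', hw'⟩ := (mem_vectorPoint β hv z).1 hz
    rw [← β.symm_apply_apply z, hw']
    exact hvS w'
  have h : q.IsIsotropic (vectorPoint β hv).ideal := hε.isotropic S hS _ hle
  rw [matrixForm_apply]
  exact h.2 _ ((mem_vectorPoint β hv _).2 ⟨w, by rw [β.apply_symm_apply, hx]⟩)

omit [IsSepClosure F Fs] [MulAction Gal(Fs/F) Y] in
theorem symm_vecMulVec_mem (hβ : IsAdaptedSplitting ε β e) {S : Set Y} {y : Y} (hy : y ∈ S)
    (w : Fin (2 * n) → Fs) :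
    β.symm (vecMulVec (Pi.single (e y) 1) w) ∈ ⨆ y ∈ S, (ε y).ideal :=
  Submodule.mem_iSup_of_mem y (Submodule.mem_iSup_of_mem hy
    ((hβ _ _).2 ⟨w, β.apply_symm_apply _⟩))

theorem matrixForm_eq_zero_of_single (hφ : ∀ y, φ y ≠ y) (hε : IsQuadricEmbedding φ q ε)
    (hβ : IsAdaptedSplitting ε β e) (y : Y) (w : Fin (2 * n) → Fs)
    (x : sym (matrixInvolution q β))
    (hx : (x : Matrix (Fin (2 * n)) (Fin (2 * n)) Fs) = vecMulVec (Pi.single (e y) 1) w) :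
    matrixForm q β x = 0 := by
  refine matrixForm_eq_zero hε {y} ?_ ?_ (symm_vecMulVec_mem hβ rfl) w x hx
  · rintro _ rfl
    exact hφ _
  · exact fun h => one_ne_zero (Pi.single_eq_zero_iff.1 h)

theorem matrixForm_eq_zero_of_add (hφ : IsGammaInvolution (Γ := Gal(Fs/F)) φ)
    (hε : IsQuadricEmbedding φ q ε)
    (hβ : IsAdaptedSplitting ε β e) {y z : Y} (hyz : z ≠ φ y) (w : Fin (2 * n) → Fs)
    (x : sym (matrixInvolution q β))
    (hx : (x : Matrix (Fin (2 * n)) (Fin (2 * n)) Fs) =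
      vecMulVec (Pi.single (e y) 1 + Pi.single (e z) 1) w) :
    matrixForm q β x = 0 := by
  -- For `y = z` the vector is `2 e_y`, which may be zero and so define no point; the factor is
  -- moved into `w`.
  by_cases h : y = z
  · subst h
    rw [add_vecMulVec, ← vecMulVec_add] at hx
    exact matrixForm_eq_zero_of_single hφ.fixedPointFree hε hβ y _ x hx
  refine matrixForm_eq_zero hε {y, z} ?_ ?_ (fun w => ?_) w x hx
  · rintro u (rfl | rfl) (hu | hu)
    · exact hφ.fixedPointFree _ hu
    · exact hyz hu.symm
    · exact hyz (by rw [← hu, hφ.involutive])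
    · exact hφ.fixedPointFree _ hu
  · intro h0
    have h1 := congrFun h0 (e y)
    rw [Pi.add_apply, Pi.single_eq_same, Pi.single_eq_of_ne (fun h2 => h (e.injective h2)),
      add_zero] at h1
    exact one_ne_zero h1
  · rw [add_vecMulVec, map_add]
    exact Submodule.add_mem _ (symm_vecMulVec_mem hβ (Or.inl rfl) w)
      (symm_vecMulVec_mem hβ (Or.inr rfl) w)

/-- In a splitting adapted to `ε`, the involution permutes the diagonal entries through `φ`, and
the linear form is `x ↦ Trd(c x)` for each diagonal `c` with `c + σ(c) = 1`. -/
theorem matrixInvolution_diagonal_and_matrixForm_eq_trace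
    (hφ : IsGammaInvolution (Γ := Gal(Fs/F)) φ)
    (hε : IsQuadricEmbedding φ q ε) (hβ : IsAdaptedSplitting ε β e) :
    (∀ c, matrixInvolution q β (diagonal c) = diagonal fun i => c (e (φ (e.symm i)))) ∧
    ∀ c : Fin (2 * n) → Fs, (∀ i, c i + c (e (φ (e.symm i))) = 1) →
      ∀ x : sym (matrixInvolution q β), matrixForm q β x =
        trace (diagonal c * (x : Matrix (Fin (2 * n)) (Fin (2 * n)) Fs)) := by
  obtain ⟨J, G, hJG, hGJ, h⟩ := exists_antiautomorphism_eq (matrixInvolution q β)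
    (matrixInvolution_mul q β) (matrixInvolution_involutive q β)
  have hJt : Jᵀ = J :=
    transpose_eq_self_of_finrank_sym (matrixInvolution_involutive q β) hJG hGJ h
      (by rw [Fintype.card_fin]; exact lt_two_mul_finrank_sym_matrixInvolution q β)
  let π : Fin (2 * n) → Fin (2 * n) := fun i => e (φ (e.symm i))
  have hπ : Function.Involutive π := fun i => by simp [π, hφ.involutive _]
  have hi : ∀ (i : Fin (2 * n)) (w : Fin (2 * n) → Fs) (x : sym (matrixInvolution q β)),
      (x : Matrix (Fin (2 * n)) (Fin (2 * n)) Fs) = vecMulVec (Pi.single i 1) w →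
        matrixForm q β x = 0 := fun i w x hx =>
    matrixForm_eq_zero_of_single hφ.fixedPointFree hε hβ (e.symm i) w x
      (by rwa [Equiv.apply_symm_apply])
  have hJ : ∀ i j, j ≠ π i → J i j = 0 := fun i j hij =>
    entry_eq_zero_of_isotropic (matrixForm q β) hGJ h hJt (matrixForm_add q β) i j (hi i) (hi j)
      fun w x hx => matrixForm_eq_zero_of_add hφ hε hβ (y := e.symm i) (z := e.symm j)
        (fun h1 => hij (by simp [π, ← h1])) w x (by simpa using hx)
  exact ⟨apply_diagonal_of_monomial hGJ h hJ hπ, fun c hc =>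
    apply_eq_trace_diagonal_mul (matrixForm q β) hJG hGJ h hJt (matrixForm_add q β) hJ hi c hc⟩

theorem apply_one_tmul_σ (hφ : IsGammaInvolution (Γ := Gal(Fs/F)) φ)
    (hε : IsQuadricEmbedding φ q ε) (hβ : IsAdaptedSplitting ε β e) (l : embeddedAlgebra ε) :
    β (1 ⊗ₜ[F] q.σ l) = diagonal fun i => hβ.character (φ (e.symm i)) l := by
  have h := (matrixInvolution_diagonal_and_matrixForm_eq_trace hφ hε hβ).1
    (fun i => hβ.character (e.symm i) l)
  rw [← hβ.apply_one_tmul, matrixInvolution_apply, β.symm_apply_apply] at h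
  simpa [QuadraticPair.σs] using h

/-- The restriction of `σ` to `L`. -/
noncomputable def restrictedInvolution (hφ : IsGammaInvolution (Γ := Gal(Fs/F)) φ)
    (hε : IsQuadricEmbedding φ q ε) (hβ : IsAdaptedSplitting ε β e) :
    embeddedAlgebra ε →ₐ[F] embeddedAlgebra ε :=
  AlgHom.ofLinearMap
    (q.σ.restrict (p := Subalgebra.toSubmodule (embeddedAlgebra ε))
      (q := Subalgebra.toSubmodule (embeddedAlgebra ε)) fun l hl =>
        (hβ.mem_stabilizerAlgebra_iff _).2 ⟨_, apply_one_tmul_σ hφ hε hβ ⟨l, hl⟩⟩)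
    (by
      apply Subtype.ext
      change q.σ 1 = 1
      have h := q.map_mul (q.σ 1) 1
      rw [mul_one, q.involutive, mul_one] at h
      exact h.symm)
    -- The map `σ` reverses products; commutativity of `L` makes its restriction a homomorphism.
    (fun l m => by
      rw [hβ.mul_comm_embeddedAlgebra]
      exact Subtype.ext (q.map_mul m l))

theorem coe_restrictedInvolution (hφ : IsGammaInvolution (Γ := Gal(Fs/F)) φ)
    (hε : IsQuadricEmbedding φ q ε) (hβ : IsAdaptedSplitting ε β e) (l : embeddedAlgebra ε) :
    (restrictedInvolution hφ hε hβ l : A) = q.σ l := rfl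

theorem character_comp_restrictedInvolution (hφ : IsGammaInvolution (Γ := Gal(Fs/F)) φ)
    (hε : IsQuadricEmbedding φ q ε) (hβ : IsAdaptedSplitting ε β e) (y : Y) :
    (hβ.character y).comp (restrictedInvolution hφ hε hβ) = hβ.character (φ y) := by
  ext l
  rw [AlgHom.comp_apply, hβ.character_apply, coe_restrictedInvolution,
    apply_one_tmul_σ hφ hε hβ, diagonal_apply_eq, Equiv.symm_apply_apply]

theorem isInvolutionEmbedding_restrictedInvolution
    (hφ : IsGammaInvolution (Γ := Gal(Fs/F)) φ)
    (hε : IsQuadricEmbedding φ q ε) (hβ : IsAdaptedSplitting ε β e) :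
    IsInvolutionEmbedding (restrictedInvolution hφ hε hβ) q (embeddedAlgebra ε).val where
  injective := Subtype.val_injective
  comm := fun _ => rfl
  trace := fun l hl x => by
    have h := (matrixInvolution_diagonal_and_matrixForm_eq_trace hφ hε hβ).2
      (fun i => hβ.character (e.symm i) l) (fun i => by
        rw [Equiv.symm_apply_apply, ← character_comp_restrictedInvolution hφ hε hβ,
          AlgHom.comp_apply, ← map_add, hl, map_one])
      ⟨β (1 ⊗ₜ[F] (x : A)), apply_mem_sym q β (q.one_tmul_mem_sym x)⟩
    rw [matrixForm_apply, ← hβ.apply_one_tmul, ← map_mul] at h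
    apply (algebraMap F Fs).injective
    rw [algebraMap_reducedTrace hA β, ← q.fs_one_tmul]
    simpa using h

end Embedding

end QuadraticPair

end QuadricEmbedding

/-! ### Assembly of the four assertions -/

theorem mainTheorem7
    {F Fs : Type*} [Field F] [Field Fs] [Algebra F Fs] [IsSepClosure F Fs]
    {A : Type*} [Ring A] [Algebra F A] {n : ℕ}
    (hA : IsCentralSimpleOfDegree F Fs A (2 * n))
    (q : QuadraticPair hA)
    {Y : Type*} [Finite Y] [TopologicalSpace Y] [DiscreteTopology Y]
    [MulAction Gal(Fs/F) Y] [ContinuousSMul Gal(Fs/F) Y] (hY : Nat.card Y = 2 * n)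
    (φ : Y → Y) (hφ : IsGammaInvolution (Γ := Gal(Fs/F)) φ)
    (ε : Y → SeveriBrauer F Fs A (2 * n))
    (hε : IsQuadricEmbedding φ q ε) :
    -- the algebra `L` is étale of dimension `2n`
    IsEtaleOfDim F Fs (embeddedAlgebra ε) (2 * n) ∧
    -- there is a unique identification `θ` of `Y` with `X(L)` under which `ε` becomes `ε_*`
    (∃! θ : Y ≃ (embeddedAlgebra ε →ₐ[F] Fs),
      ∀ y, (ε y).ideal = pointIdeal (embeddedAlgebra ε).val (θ y)) ∧
    ∀ θ : Y ≃ (embeddedAlgebra ε →ₐ[F] Fs),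
      (∀ y, (ε y).ideal = pointIdeal (embeddedAlgebra ε).val (θ y)) →
      -- this identification is an isomorphism of `Γ`-sets
      (∀ (γ : Gal(Fs/F)) (y : Y), θ (γ • y) = (γ : Fs →ₐ[F] Fs).comp (θ y)) ∧
      -- there is a unique `σ_L` with `X(σ_L) = φ`
      (∃! σL : embeddedAlgebra ε →ₐ[F] embeddedAlgebra ε,
        ∀ y, (θ y).comp σL = θ (φ y)) ∧
      -- and it is an involution making the inclusion an embedding of algebras with involution
      ∀ σL : embeddedAlgebra ε →ₐ[F] embeddedAlgebra ε,
        (∀ y, (θ y).comp σL = θ (φ y)) →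
        IsEtaleInvolution F Fs σL ∧
        IsInvolutionEmbedding σL q (embeddedAlgebra ε).val := by
  obtain ⟨β, e, hβ⟩ := exists_isAdaptedSplitting hA hY ε hε.span_eq_top
  have hstab := galoisMap_mem_stabilizerAlgebra hε.equivariant
  have hθ : ∀ θ : Y ≃ (embeddedAlgebra ε →ₐ[F] Fs),
      (∀ y, (ε y).ideal = pointIdeal (embeddedAlgebra ε).val (θ y)) →
        ∀ y, θ y = hβ.character y :=
    fun θ h y => hβ.eq_character_of_ideal_eq (h y)
  refine ⟨hβ.isEtaleOfDim hstab,
    ⟨Equiv.ofBijective hβ.character (hβ.bijective_character hstab hε.injective),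
      hβ.ideal_eq_pointIdeal hstab, fun θ h => Equiv.ext (hθ θ h)⟩, fun θ h => ?_⟩
  have hunique : ∀ s : embeddedAlgebra ε →ₐ[F] embeddedAlgebra ε,
      (∀ y, (θ y).comp s = θ (φ y)) → s = restrictedInvolution hφ hε hβ := by
    intro s hs
    ext1 l
    refine hβ.eq_of_character_eq fun y => ?_
    have h1 := hs y
    rw [hθ θ h, hθ θ h, ← character_comp_restrictedInvolution hφ hε hβ] at h1
    exact DFunLike.congr_fun h1 l
  have hexists : ∀ y, (θ y).comp (restrictedInvolution hφ hε hβ) = θ (φ y) := fun y => by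
    rw [hθ θ h, hθ θ h, character_comp_restrictedInvolution]
  refine ⟨fun γ y => ?_, ⟨_, hexists, hunique⟩, fun s hs => ?_⟩
  · rw [hθ θ h (γ • y)]
    -- Equivariance follows from uniqueness: `γ ∘ θ(y)` also cuts out the ideal `ε(γ • y)`.
    refine (hβ.eq_character_of_ideal_eq ?_).symm
    rw [hε.equivariant, h y, galoisConj_pointIdeal]
  · rw [hunique s hs]
    refine ⟨⟨fun l => Subtype.ext (q.involutive l), fun ξ hξ => ?_⟩,
      isInvolutionEmbedding_restrictedInvolution hφ hε hβ⟩
    obtain ⟨y, rfl⟩ := θ.surjective ξ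
    rw [hexists] at hξ
    exact hφ.fixedPointFree y (θ.injective hξ)
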